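/- All graphs are finite, simple and undirected. Fix $n \ge 4$, and let $P_n$ be the path on $n$ vertices. For a graph $G$, the $P_n$-line graph $HL(G)$ is the graph whose vertices are the edges of $G$, where two distinct edges of $G$ are adjacent in $HL(G)$ if and only if they share an endpoint and lie in a common subgraph of $G$ isomorphic to $P_n$. Put $HL^0(G) = G$ and $HL^{k+1}(G) = HL(HL^k(G))$. We say that $G$ diverges by order if for every positive integer $N$ there is an integer $k \ge 0$ with $|V(HL^k(G))| \ge N$. For $m \ge 3$ and $r \ge 0$, let $G^r_m$ be the graph on $m + r$ vertices formed by a cycle on $m$ vertices and a disjoint path on $r$ vertices, together with (if $r \ge 1$) one edge joining a vertex of the cycle to an end vertex of the path; thus $G^0_m$ is the cycle $C_m$. Let $\delta_n$ be the class of all graphs isomorphic to some $G^r_m$ with $m \ge 3$, $r \ge 0$ and $r + m = n$. **Theorem.** Let $G$ be a graph, and let $G_1$ and $G_2$ be subgraphs of $G$ (not necessarily induced), both contained in the same connected component of $G$, with $G_1 \in \delta_n$ and $G_2 \in \delta_n$. If $G_1 \ne G_2$, that is, $V(G_1) \ne V(G_2)$ or $E(G_1) \ne E(G_2)$, then $G$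 diverges by order. -/

import Mathlib

namespace HLine

universe u

/-- Two edges `e`, `f` of `G` lie in a common subgraph of `G` isomorphic to `H`. -/
def InCommonCopy {W : Type*} (H : SimpleGraph W) {V : Type u} (G : SimpleGraph V)
    (e f : Sym2 V) : Prop :=
  ∃ S : G.Subgraph, Nonempty (S.coe ≃g H) ∧ e ∈ S.edgeSet ∧ f ∈ S.edgeSet

/-- The `H`-line graph `HL(G)`: its vertices are the edges of `G`; two of them are adjacent if,
as edges of `G`, they are adjacent (distinct with a common endpoint) and lie in a common copy
of `H`. -/
def hLineGraph {W : Type*} (H : SimpleGraph W) {V : Type u} (G : SimpleGraph V) :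
    SimpleGraph G.edgeSet where
  Adj e f := G.lineGraph.Adj e f ∧ InCommonCopy H G e f
  symm := ⟨by
    rintro e f ⟨h, S, hS, he, hf⟩
    exact ⟨h.symm, S, hS, hf, he⟩⟩
  loopless := ⟨fun e h => G.lineGraph.irrefl h.1⟩

/-- A graph bundled with its vertex type. The vertex type changes at each step of the sequence
of iterated `H`-line graphs. -/
structure BundledGraph where
  Vert : Type u
  graph : SimpleGraph Vert

/-- The iterated `H`-line graphs: `HL^0(G) = G` and `HL^(k+1)(G) = HL(HL^k(G))`. -/
def hLineIter {W : Type*} (H : SimpleGraph W) {V : Type u} (G : SimpleGraph V) :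
    ℕ → BundledGraph.{u}
  | 0 => ⟨V, G⟩
  | k + 1 => ⟨(hLineIter H G k).graph.edgeSet, hLineGraph H (hLineIter H G k).graph⟩

/-- The sequence `HL^k(G)` diverges by order: for every positive integer `N` there is `k` with
`|V(HL^k(G))| ≥ N`. -/
def DivergesByOrder {W : Type*} (H : SimpleGraph W) {V : Type u} (G : SimpleGraph V) : Prop :=
  ∀ N : ℕ, 0 < N → ∃ k : ℕ, N ≤ Nat.card (hLineIter H G k).Vert

/-- The graph `G^r_m`: a cycle on `m` vertices (the left summand) and a path on `r` vertices
(the right summand), with one more edge joining a vertex of the cycle to an end of the path.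
For `r = 0` it is the cycle alone. -/
def cycleWithTail (m r : ℕ) : SimpleGraph (Fin m ⊕ Fin r) where
  Adj
    | .inl i, .inl j => (SimpleGraph.cycleGraph m).Adj i j
    | .inr i, .inr j => (SimpleGraph.pathGraph r).Adj i j
    | .inl i, .inr j => i.val = 0 ∧ j.val = 0
    | .inr i, .inl j => i.val = 0 ∧ j.val = 0
  symm := ⟨by
    rintro (i | i) (j | j) h
    · exact SimpleGraph.Adj.symm h
    · exact ⟨h.2, h.1⟩
    · exact ⟨h.2, h.1⟩
    · exact SimpleGraph.Adj.symm h⟩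
  loopless := ⟨by
    rintro (i | i) h
    · exact SimpleGraph.irrefl _ h
    · exact SimpleGraph.irrefl _ h⟩

/-- `G` belongs (up to isomorphism) to `δ_n = {G^r_m : r + m = n}`. -/
def MemDelta (n : ℕ) {V : Type*} (G : SimpleGraph V) : Prop :=
  ∃ m r : ℕ, 3 ≤ m ∧ r + m = n ∧ Nonempty (G ≃g cycleWithTail m r)

end HLine

/-! A graph in `δ_n` is a lollipop: a path `f 0, …, f (n - 1)` whose last vertex is joined back to
some `f j`. Its `n` edges, in this order, form a lollipop in the `P_n`-line graph, with one tail
vertex turned into a cycle vertex (`IsLollipop.edges`), so `j` steps produce an `n`-cycle. If the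
second lollipop is still different and in the same component, some edge outside this cycle touches
it. In the line graph that edge becomes a vertex that fits between the two cycle edges at its end,
and these two edges remain adjacent as a chord: a touched `N`-cycle gives a touched `(N + 1)`-cycle
(`HasTouchedCycle.succ`), and the orders are unbounded.

The hard point is that the lollipops stay in one component, since an edge of `G` may be isolated in
the line graph. By `edgeReachable_of_paths`, the edges of all paths on `n` vertices in one component
of `G` lie in one component of the line graph. It suffices to find a path on at least `n` vertices
with edges of both given paths. Disjoint paths are joined through their longer halves, and an end of
one path on the other is handled by rotation.

For paths that cross without such ends, all four ends are identified to one vertex. The paths become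
two closed trails, each visiting every common vertex exactly once. Thomason's parity argument
(`even_card_hamColorings`) gives a second decomposition of this kind. Both of its trails use edges
of both paths, and the longer one, cut at the identified vertex, is the path that is needed
(`exists_mixed_path`). -/

namespace HLine

open SimpleGraph

universe u

/-! ### Paths and adjacency of edges in the `P_n`-line graph -/

variable {V : Type u} {G : SimpleGraph V}

/-- The vertices `p 0, …, p k` form a path with `k` edges in `G`. -/
structure IsPathFn (G : SimpleGraph V) (p : ℕ → V) (k : ℕ) : Prop where
  adj : ∀ i, i < k → G.Adj (p i) (p (i + 1))
  inj : ∀ i j, i ≤ k → j ≤ k → p i = p j → i = j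

namespace IsPathFn

variable {p q : ℕ → V} {k l : ℕ}

theorem reverse (h : IsPathFn G p k) : IsPathFn G (fun i => p (k - i)) k where
  adj i hi := by
    have := (h.adj (k - (i + 1)) (by omega)).symm
    rwa [show k - (i + 1) + 1 = k - i by omega] at this
  inj i j hi hj hij := by
    have := h.inj _ _ (by omega) (by omega) hij
    omega

theorem drop (h : IsPathFn G p k) {a : ℕ} (ha : a ≤ k) :
    IsPathFn G (fun i => p (a + i)) (k - a) where
  adj i hi := h.adj (a + i) (by omega)
  inj i j hi hj hij := by
    have := h.inj _ _ (by omega) (by omega) hij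
    omega

theorem mono (h : IsPathFn G p k) (hl : l ≤ k) : IsPathFn G p l where
  adj i hi := h.adj i (by omega)
  inj i j hi hj hij := h.inj _ _ (by omega) (by omega) hij

theorem cons (h : IsPathFn G p k) {w : V} (hw : G.Adj w (p 0)) (hp : ∀ i ≤ k, p i ≠ w) :
    IsPathFn G (fun i => if i = 0 then w else p (i - 1)) (k + 1) where
  adj i hi := by
    rcases i with - | i
    · simpa using hw
    · simpa using h.adj i (by omega)
  inj i j hi hj hij := by
    rcases i with - | i <;> rcases j with - | j <;> simp at hij ⊢
    · exact hp j (by omega) hij.symm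
    · exact hp i (by omega) hij
    · exact h.inj _ _ (by omega) (by omega) hij

/-- Concatenation of two paths that meet only in the end of the first one. -/
theorem append (hp : IsPathFn G p k) (hq : IsPathFn G q l) (hpq : p k = q 0)
    (hd : ∀ i j, i ≤ k → j ≤ l → p i = q j → j = 0) :
    IsPathFn G (fun i => if i ≤ k then p i else q (i - k)) (k + l) where
  adj i hi := by
    by_cases h1 : i + 1 ≤ k
    · simpa [h1, show i ≤ k by omega] using hp.adj i (by omega)
    · by_cases h2 : i = k
      · subst h2
        simpa [hpq] using hq.adj 0 (by omega)
      · have := hq.adj (i - k) (by omega)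
        rw [show i - k + 1 = i + 1 - k by omega] at this
        simpa [h1, show ¬ i ≤ k by omega] using this
  inj i j hi hj hij := by
    by_cases h1 : i ≤ k <;> by_cases h2 : j ≤ k <;> simp only [h1, h2, if_true, if_false] at hij
    · exact hp.inj _ _ h1 h2 hij
    · have := hd _ _ h1 (by omega) hij
      omega
    · have := hd _ _ h2 (by omega) hij.symm
      omega
    · have := hq.inj _ _ (by omega) (by omega) hij
      omega

/-- Rotation of a path along a chord at its first vertex. -/
theorem rotate (h : IsPathFn G p k) {j : ℕ} (hj : 0 < j) (hjk : j ≤ k) (hadj : G.Adj (p 0) (p j)) :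
    IsPathFn G (fun i => if i < j then p (j - 1 - i) else p i) k where
  adj i hi := by
    by_cases h1 : i + 1 < j
    · have := (h.adj (j - 1 - (i + 1)) (by omega)).symm
      rw [show j - 1 - (i + 1) + 1 = j - 1 - i by omega] at this
      simpa [h1, show i < j by omega] using this
    · by_cases h2 : i < j
      · obtain rfl : j = i + 1 := by omega
        simpa using hadj
      · simpa [h1, h2] using h.adj i hi
  inj a b ha hb hab := by
    by_cases h1 : a < j <;> by_cases h2 : b < j <;> simp only [h1, h2, if_true, if_false] at hab <;>
      have := h.inj _ _ (by omega) (by omega) hab <;> omega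

end IsPathFn

theorem pathGraph_inCommonCopy {n o : ℕ} {p : ℕ → V} (hp : IsPathFn G (fun i => p (o + i)) (n - 1))
    {i j : ℕ} (hoi : o ≤ i) (hi : i + 1 < o + n) (hoj : o ≤ j) (hj : j + 1 < o + n) :
    InCommonCopy (pathGraph n) G s(p i, p (i + 1)) s(p j, p (j + 1)) := by
  let φ : pathGraph n →g G :=
    { toFun := fun x => p (o + x)
      map_rel' := by
        intro x y hxy
        rcases pathGraph_adj.1 hxy with h | h
        · rw [← h]
          exact hp.adj x (by omega)
        · rw [← h]
          exact (hp.adj y (by omega)).symm }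
  have hφ : Function.Injective φ := by
    intro x y hxy
    have := hp.inj x y (by omega) (by omega) hxy
    exact Fin.ext this
  let c : Copy (pathGraph n) G := ⟨φ, hφ⟩
  have key : ∀ i, o ≤ i → i + 1 < o + n → s(p i, p (i + 1)) ∈ c.toSubgraph.edgeSet := by
    intro i hoi hi
    rw [Subgraph.mem_edgeSet, Copy.toSubgraph, Subgraph.map_adj]
    refine ⟨⟨i - o, by omega⟩, ⟨i + 1 - o, by omega⟩, ?_, ?_, ?_⟩
    · rw [Subgraph.top_adj, pathGraph_adj]
      left
      simp
      omega
    · change p (o + (i - o)) = _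
      congr 1
      omega
    · change p (o + (i + 1 - o)) = _
      congr 1
      omega
  exact ⟨c.toSubgraph, ⟨c.isoToSubgraph.symm⟩, key i hoi hi, key j hoj hj⟩

/-- `e` and `f` are edges of `G` that are adjacent in the `P_n`-line graph of `G`. -/
def EdgeAdj (n : ℕ) (G : SimpleGraph V) (e f : Sym2 V) : Prop :=
  ∃ (he : e ∈ G.edgeSet) (hf : f ∈ G.edgeSet), (hLineGraph (pathGraph n) G).Adj ⟨e, he⟩ ⟨f, hf⟩

theorem EdgeAdj.symm {n : ℕ} {e f : Sym2 V} (h : EdgeAdj n G e f) : EdgeAdj n G f e := by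
  obtain ⟨he, hf, h⟩ := h
  exact ⟨hf, he, h.symm⟩

theorem IsPathFn.edgeAdj {n k : ℕ} {p : ℕ → V} (hp : IsPathFn G p k) (hn : 3 ≤ n) (hk : n ≤ k + 1)
    {i : ℕ} (hi : i + 2 ≤ k) :
    EdgeAdj n G s(p i, p (i + 1)) s(p (i + 1), p (i + 2)) := by
  refine ⟨hp.adj i (by omega), hp.adj (i + 1) (by omega), ?_, ?_⟩
  · rw [lineGraph_adj_iff_exists]
    refine ⟨?_, p (i + 1), by simp, by simp⟩
    intro h
    have h' := congrArg Subtype.val h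
    rw [Sym2.eq_iff] at h'
    rcases h' with ⟨h1, -⟩ | ⟨h1, -⟩
    · have := hp.inj _ _ (by omega) (by omega) h1
      omega
    · have := hp.inj _ _ (by omega) (by omega) h1
      omega
  · have ho : min i (k + 1 - n) ≤ k := by omega
    exact pathGraph_inCommonCopy (o := min i (k + 1 - n)) ((hp.drop ho).mono (by omega))
      (by omega) (by omega) (by omega) (by omega)

/-- A path on at least `n` vertices together with a further edge at its first vertex. -/
theorem IsPathFn.edgeAdj_extra {n k : ℕ} {p : ℕ → V} (hp : IsPathFn G p k) (hn : 3 ≤ n)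
    (hk : n ≤ k + 1) {w : V} (hw : G.Adj (p 0) w) (hw1 : w ≠ p 1) :
    EdgeAdj n G s(p 0, p 1) s(p 0, w) := by
  by_cases h : ∃ j ≤ k, p j = w
  · obtain ⟨j, hjk, rfl⟩ := h
    have h0 : j ≠ 0 := by
      rintro rfl
      exact G.irrefl hw
    have h1 : j ≠ 1 := by
      rintro rfl
      exact hw1 rfl
    -- The rotated path runs `p (j - 1), …, p 1, p 0, p j, …`, so both edges are consecutive on it.
    have := (hp.rotate (by omega) hjk hw).edgeAdj hn hk (i := j - 2) (by omega)
    simp only [show j - 2 < j by omega, show j - 2 + 1 < j by omega, show j - 2 + 2 = j by omega,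
      lt_irrefl, if_true, if_false, show j - 1 - (j - 2) = 1 by omega,
      show j - 1 - (j - 2 + 1) = 0 by omega] at this
    rwa [Sym2.eq_swap]
  · push Not at h
    have := (hp.cons hw.symm h).edgeAdj hn (by omega) (i := 0) (by omega)
    simp at this
    rw [Sym2.eq_swap (a := p 0) (b := w)]
    exact this.symm

/-! ### Lollipops and their edges -/

/-- A path `f 0, …, f (N - 1)` with one further edge from its last vertex to `f j`: a cycle of
length `N - j` with a tail on `j` vertices. -/
structure IsLollipop (G : SimpleGraph V) (N : ℕ) (f : ℕ → V) (j : ℕ) : Prop where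
  path : IsPathFn G f (N - 1)
  close : G.Adj (f (N - 1)) (f j)
  le : j + 3 ≤ N

/-- The `i`-th edge of a lollipop. -/
def lollipopEdge (N : ℕ) (f : ℕ → V) (j i : ℕ) : Sym2 V :=
  if i + 1 < N then s(f i, f (i + 1)) else s(f (N - 1), f j)

theorem lollipopEdge_of_lt {N : ℕ} {f : ℕ → V} {j i : ℕ} (h : i + 1 < N) :
    lollipopEdge N f j i = s(f i, f (i + 1)) := if_pos h

theorem lollipopEdge_last {N : ℕ} {f : ℕ → V} {j : ℕ} :
    lollipopEdge N f j (N - 1) = s(f (N - 1), f j) := if_neg (by omega)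

namespace IsLollipop

variable {N j : ℕ} {f : ℕ → V}

theorem lollipopEdge_mem (h : IsLollipop G N f j) (i : ℕ) : lollipopEdge N f j i ∈ G.edgeSet := by
  unfold lollipopEdge
  split_ifs with hi
  · exact h.path.adj i (by omega)
  · exact h.close

theorem lollipopEdge_inj (h : IsLollipop G N f j) (a b : ℕ) (ha : a < N) (hb : b < N)
    (hab : lollipopEdge N f j a = lollipopEdge N f j b) : a = b := by
  have hinj := h.path.inj
  have hle := h.le
  unfold lollipopEdge at hab
  split_ifs at hab with h1 h2 h2 <;> rw [Sym2.eq_iff] at hab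
  · rcases hab with ⟨h3, -⟩ | ⟨h3, h4⟩
    · exact hinj _ _ (by omega) (by omega) h3
    · have := hinj _ _ (by omega) (by omega) h3
      have := hinj _ _ (by omega) (by omega) h4
      omega
  · rcases hab with ⟨h3, h4⟩ | ⟨h3, h4⟩ <;>
      have := hinj _ _ (by omega) (by omega) h3 <;>
      have := hinj _ _ (by omega) (by omega) h4 <;> omega
  · rcases hab with ⟨h3, h4⟩ | ⟨h3, h4⟩ <;>
      have := hinj _ _ (by omega) (by omega) h3 <;>
      have := hinj _ _ (by omega) (by omega) h4 <;> omega
  · omega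

/-- The edges of a lollipop form a lollipop with a shorter tail in the `P_n`-line graph. -/
theorem edges (h : IsLollipop G N f j) {n : ℕ} (hn : 3 ≤ n) (hN : n ≤ N) :
    IsLollipop (hLineGraph (pathGraph n) G) N
      (fun i => ⟨lollipopEdge N f j i, h.lollipopEdge_mem i⟩) (j - 1) := by
  have hle := h.le
  have step : ∀ i, i + 1 < N →
      EdgeAdj n G (lollipopEdge N f j i) (lollipopEdge N f j (i + 1)) := by
    intro i hi
    by_cases h1 : i + 2 < N
    · rw [lollipopEdge_of_lt hi, lollipopEdge_of_lt h1]
      exact h.path.edgeAdj hn (by omega) (by omega)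
    · obtain rfl : i = N - 2 := by omega
      -- The closing edge is an extra edge at the first vertex of the reversed path.
      have := h.path.reverse.edgeAdj_extra (n := n) hn (by omega) (w := f j) (by simpa using h.close)
        (by
          intro h2
          have := h.path.inj _ _ (by omega) (by omega) h2
          omega)
      rw [show N - 2 + 1 = N - 1 by omega, lollipopEdge_last, lollipopEdge_of_lt (by omega),
        show N - 2 + 1 = N - 1 by omega, Sym2.eq_swap]
      simpa [show N - 1 - 1 = N - 2 by omega] using this
  refine ⟨⟨?_, ?_⟩, ?_, by omega⟩
  · intro i hi
    obtain ⟨_, _, h3⟩ := step i (by omega)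
    exact h3
  · intro a b ha hb hab
    exact h.lollipopEdge_inj a b (by omega) (by omega) (congrArg Subtype.val hab)
  -- The closing edge meets both cycle edge `j` and tail edge `j - 1` at `f j`; closing up at the
  -- latter shortens the tail. For `j = 0` truncated subtraction gives edge `0`, and the cycle keeps
  -- its length.
  · suffices EdgeAdj n G (lollipopEdge N f j (N - 1)) (lollipopEdge N f j (j - 1)) by
      obtain ⟨_, _, h3⟩ := this
      exact h3
    rw [lollipopEdge_last, lollipopEdge_of_lt (by omega)]
    rcases j with - | j
    · have := h.path.edgeAdj_extra (n := n) hn (by omega) h.close.symm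
        (by
          intro h2
          have := h.path.inj _ _ (by omega) (by omega) h2
          omega)
      rw [Sym2.eq_swap]
      exact this.symm
    -- Rotation along the closing edge makes `f (N - 1)`, `f (j + 1)`, `f j` consecutive, where `j +
    -- 1` is the original tail length.
    · have hr := h.path.reverse.rotate (j := N - 1 - (j + 1)) (by omega) (by omega)
        (by simpa [show N - 1 - (N - 1 - (j + 1)) = j + 1 by omega] using h.close)
      have := hr.edgeAdj (n := n) hn (by omega) (i := N - 1 - (j + 1) - 1) (by omega)
      simp only [show N - 1 - (j + 1) - 1 < N - 1 - (j + 1) by omega,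
        show ¬ N - 1 - (j + 1) - 1 + 1 < N - 1 - (j + 1) by omega,
        show ¬ N - 1 - (j + 1) - 1 + 2 < N - 1 - (j + 1) by omega, if_true, if_false,
        show N - 1 - (N - 1 - (j + 1) - 1 + 1) = j + 1 by omega,
        show N - 1 - (N - 1 - (j + 1) - 1 + 2) = j by omega,
        show N - 1 - (N - 1 - (j + 1) - 1 - (N - 1 - (j + 1) - 1)) = N - 1 by omega] at this
      simpa [Sym2.eq_swap (a := f j)] using this

end IsLollipop

/-! ### Touched cycles grow -/

/-- `G` has a cycle of length `N` and an edge outside of this cycle that touches it. -/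
def HasTouchedCycle (G : SimpleGraph V) (N : ℕ) : Prop :=
  ∃ (f : ℕ → V) (w : V), IsLollipop G N f 0 ∧ G.Adj (f 0) w ∧ w ≠ f 1 ∧ w ≠ f (N - 1)

/-- The edge to `w` is adjacent to both cycle edges at `f 0`, so it can be inserted between them.
Their old adjacency becomes a chord, which touches the longer cycle again. -/
theorem HasTouchedCycle.succ {n N : ℕ} (hn : 3 ≤ n) (hN : n ≤ N) (h : HasTouchedCycle G N) :
    HasTouchedCycle (hLineGraph (pathGraph n) G) (N + 1) := by
  obtain ⟨f, w, hf, hw, hw1, hw2⟩ := h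
  have hle := hf.le
  have hinj := hf.path.inj
  have h0 : EdgeAdj n G s(f 0, f 1) s(f 0, w) := hf.path.edgeAdj_extra hn (by omega) hw hw1
  have h1 : EdgeAdj n G s(f (N - 1), f 0) s(f 0, w) := by
    -- the same path, starting at `f 0` in the other direction
    have hp : IsPathFn G (fun i => if i = 0 then f 0 else f (N - i)) (N - 1) := by
      refine ⟨?_, ?_⟩
      · intro i hi
        rcases i with - | i
        · simpa using hf.close.symm
        · have := (hf.path.adj (N - (i + 1 + 1)) (by omega)).symm
          rw [show N - (i + 1 + 1) + 1 = N - (i + 1) by omega] at this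
          simpa using this
      · intro a b ha hb hab
        by_cases h3 : a = 0 <;> by_cases h4 : b = 0 <;>
          simp only [h3, h4, if_true, if_false] at hab ⊢ <;>
          have := hinj _ _ (by omega) (by omega) hab <;> omega
    have := hp.edgeAdj_extra (n := n) hn (by omega) (w := w) (by simpa using hw) (by simpa using hw2)
    simp at this
    rwa [Sym2.eq_swap (a := f (N - 1))]
  have hL := hf.edges hn hN
  have hmem : s(f 0, w) ∈ G.edgeSet := hw
  have hne : ∀ i < N, lollipopEdge N f 0 i ≠ s(f 0, w) := by
    intro i hi h2
    unfold lollipopEdge at h2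
    split_ifs at h2 with h3 <;> rw [Sym2.eq_iff] at h2
    · rcases h2 with ⟨h4, h5⟩ | ⟨h4, h5⟩
      · obtain rfl := hinj _ _ (by omega) (by omega) h4
        exact hw1 h5.symm
      · have := hinj _ _ (by omega) (by omega) h5
        omega
    · rcases h2 with ⟨h4, h5⟩ | ⟨h4, h5⟩
      · have := hinj _ _ (by omega) (by omega) h4
        omega
      · exact hw2 h4.symm
  -- The inserted vertex gets index `N`; the touching edge is the chord from edge `0` to edge `N -
  -- 1`.
  refine ⟨fun i => if i < N then ⟨lollipopEdge N f 0 i, hf.lollipopEdge_mem i⟩ else ⟨s(f 0, w), hmem⟩,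
    ⟨lollipopEdge N f 0 (N - 1), hf.lollipopEdge_mem _⟩, ⟨⟨?_, ?_⟩, ?_, by omega⟩, ?_, ?_, ?_⟩
  · intro i hi
    by_cases h3 : i + 1 < N
    · simpa [h3, show i < N by omega] using hL.path.adj i (by omega)
    · obtain rfl : i = N - 1 := by omega
      obtain ⟨_, _, h4⟩ := h1
      simpa [h3, show N - 1 < N by omega, lollipopEdge_last] using h4
  · intro a b ha hb hab
    by_cases h3 : a < N <;> by_cases h4 : b < N <;>
      simp only [h3, h4, if_true, if_false, Subtype.mk.injEq] at hab
    · exact hf.lollipopEdge_inj a b h3 h4 hab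
    · exact (hne a h3 hab).elim
    · exact (hne b h4 hab.symm).elim
    · omega
  · obtain ⟨_, _, h4⟩ := h0.symm
    simpa [show 0 < N by omega, lollipopEdge_of_lt (i := 0) (show 0 + 1 < N by omega)] using h4
  · simpa [show 0 < N by omega] using hL.close.symm
  · simp only [show 1 < N by omega, if_true, ne_eq, Subtype.mk.injEq]
    intro h3
    have := hf.lollipopEdge_inj _ _ (by omega) (by omega) h3
    omega
  · simp only [Nat.add_sub_cancel, lt_irrefl, if_false, ne_eq, Subtype.mk.injEq]
    exact hne _ (by omega)

instance hLineIter_finite {W : Type*} (H : SimpleGraph W) [Finite V] (k : ℕ) :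
    Finite (hLineIter H G k).Vert := by
  induction k with
  | zero => exact ‹Finite V›
  | succ k ih =>
    change Finite (hLineIter H G k).graph.edgeSet
    infer_instance

theorem HasTouchedCycle.iterate {n N k : ℕ} (hn : 3 ≤ n) (hN : n ≤ N)
    (h : HasTouchedCycle (hLineIter (pathGraph n) G k).graph N) (l : ℕ) :
    HasTouchedCycle (hLineIter (pathGraph n) G (k + l)).graph (N + l) := by
  induction l with
  | zero => exact h
  | succ l ih => exact ih.succ hn (hN.trans (Nat.le_add_right N l))

theorem HasTouchedCycle.le_card [Finite V] {N : ℕ} (h : HasTouchedCycle G N) : N ≤ Nat.card V := by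
  obtain ⟨f, -, hf, -⟩ := h
  have hle := hf.le
  have := Nat.card_le_card_of_injective (fun i : Fin N => f i)
    (fun a b hab => Fin.ext (hf.path.inj _ _ (by omega) (by omega) hab))
  simpa using this

theorem HasTouchedCycle.divergesByOrder [Finite V] {n N k : ℕ} (hn : 3 ≤ n) (hN : n ≤ N)
    (h : HasTouchedCycle (hLineIter (pathGraph n) G k).graph N) :
    DivergesByOrder (pathGraph n) G := by
  intro M _
  exact ⟨k + M, (Nat.le_add_left M N).trans (h.iterate hn hN M).le_card⟩

end HLine

namespace HLine

open Equiv

/-! ### Orbits of a product of two involutions -/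

section Dihedral

variable {D : Type*} {ι τ : Perm D}

/-- The dihedral relation: conjugation by `τ` inverts `τ * ι`. -/
theorem zpow_mul_involutive (hι : ∀ d, ι (ι d) = d) (hτ : ∀ d, τ (τ d) = d) (k : ℤ) (d : D) :
    τ (((τ * ι) ^ k) d) = ((τ * ι) ^ (-k)) (τ d) := by
  have h : SemiconjBy τ (τ * ι) (τ * ι)⁻¹ := by
    rw [SemiconjBy, eq_inv_mul_iff_mul_eq]
    ext d
    simp [hι, hτ]
  have h2 := h.zpow_right k
  rw [inv_zpow, ← zpow_neg] at h2
  exact DFunLike.congr_fun h2 d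

theorem sameCycle_involution_left (hι : ∀ d, ι (ι d) = d) (hτ : ∀ d, τ (τ d) = d) {z d : D}
    (hz : τ z = z) (h : (τ * ι).SameCycle z d) : (τ * ι).SameCycle z (τ d) := by
  obtain ⟨k, rfl⟩ := h
  rw [zpow_mul_involutive hι hτ, hz]
  exact ⟨-k, rfl⟩

theorem sameCycle_involution_right (hι : ∀ d, ι (ι d) = d) (hτ : ∀ d, τ (τ d) = d) {z d : D}
    (hz : τ z = z) (h : (τ * ι).SameCycle z d) : (τ * ι).SameCycle z (ι d) := by
  have := sameCycle_involution_left hι hτ hz (Perm.sameCycle_apply_right.2 h)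
  simpa [hτ] using this

/-- A cycle of the product of two involutions, the second one without fixed points, that contains
a fixed point of the first one contains exactly two of them. -/
theorem exists_unique_other_fixed [Finite D] (hι : ∀ d, ι (ι d) = d) (hι' : ∀ d, ι d ≠ d)
    (hτ : ∀ d, τ (τ d) = d) {z : D} (hz : τ z = z) :
    ∃ z', z' ≠ z ∧ τ z' = z' ∧ (τ * ι).SameCycle z z' ∧
      ∀ d, (τ * ι).SameCycle z d → τ d = d → d = z ∨ d = z' := by
  set ρ := τ * ι with hρ
  have hdvd : ∀ k : ℤ, (ρ ^ k) z = z ↔ (MulAction.period ρ z : ℤ) ∣ k := fun k => by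
    rw [← Perm.smul_def]
    exact MulAction.zpow_smul_eq_iff_period_dvd
  have hpos : 0 < MulAction.period ρ z :=
    MulAction.period_pos_of_orderOf_pos (orderOf_pos ρ) z
  set m := MulAction.period ρ z
  -- Since `τ` sends `(ρ ^ k) z` to `(ρ ^ (-k)) z`, it fixes this point exactly when `m ∣ 2 * k`.
  -- For `m = 2 * l` the other solution is `k = l`; an odd `m = 2 * l + 1` would make `(ρ ^ l) z` a
  -- fixed point of `ι`.
  rcases Nat.even_or_odd' m with ⟨l, hl | hl⟩
  · refine ⟨(ρ ^ (l : ℤ)) z, ?_, ?_, ⟨l, rfl⟩, ?_⟩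
    · rw [ne_eq, hdvd, hl]
      intro h
      have := Int.le_of_dvd (by omega) h
      omega
    · rw [zpow_mul_involutive hι hτ, hz]
      have : (ρ ^ (l : ℤ)) ((ρ ^ (l : ℤ)) z) = z := by
        rw [← Perm.mul_apply, ← zpow_add, hdvd, hl]
        exact ⟨1, by push_cast; ring⟩
      rw [zpow_neg, Perm.inv_eq_iff_eq, this]
    · rintro d ⟨k, rfl⟩ hd
      rw [zpow_mul_involutive hι hτ, hz, zpow_neg, Perm.inv_eq_iff_eq, ← Perm.mul_apply,
        ← zpow_add] at hd
      obtain ⟨q, hq⟩ := (hdvd _).1 hd.symm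
      rw [hl] at hq
      have hk : k = l * q := by
        push_cast at hq
        linarith
      rcases Int.even_or_odd' q with ⟨s, rfl | rfl⟩
      · left
        rw [hdvd, hl, hk]
        exact ⟨s, by push_cast; ring⟩
      · right
        rw [hk, show (l : ℤ) * (2 * s + 1) = l + 2 * l * s by ring, zpow_add, Perm.mul_apply]
        congr 1
        rw [hdvd, hl]
        exact ⟨s, by push_cast; ring⟩
  · exfalso
    have h1 : (ρ ^ (m : ℤ)) z = z := (hdvd _).2 dvd_rfl
    have h2 : (ρ ^ ((l : ℤ) + 1)) z = τ ((ρ ^ (l : ℤ)) z) := by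
      rw [zpow_mul_involutive hι hτ, hz, zpow_neg, Perm.eq_inv_iff_eq, ← Perm.mul_apply,
        ← zpow_add]
      convert h1 using 3
      rw [hl]
      push_cast
      ring
    rw [add_comm, zpow_add, zpow_one, Perm.mul_apply, hρ, Perm.mul_apply, τ.injective.eq_iff] at h2
    exact hι' _ h2

end Dihedral

theorem even_card_of_involution {α : Type*} (s : Finset α) (g : α → α) (hs : ∀ a ∈ s, g a ∈ s)
    (hne : ∀ a ∈ s, g a ≠ a) (hg : ∀ a ∈ s, g (g a) = a) : Even s.card := by
  rw [← ZMod.natCast_eq_zero_iff_even, Finset.card_eq_sum_ones, Nat.cast_sum]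
  exact Finset.sum_involution (fun a _ => g a) (fun a _ => by decide) (fun a ha _ => hne a ha) hs hg

/-! ### Hamiltonian colourings -/

section Coloring

variable {D : Type*} {W : Type*}

/-- The darts of a multigraph are given with the involution `ι` that exchanges the two darts of an
edge, and with their vertices. At the vertices outside of `U` the transitions `τ` from dart to
dart are prescribed. -/
structure IsTransition (ι τ : Perm D) (vtx : D → W) (U : Finset W) : Prop where
  inv_edge : ∀ d, ι (ι d) = d
  edge_ne : ∀ d, ι d ≠ d
  inv_trans : ∀ d, τ (τ d) = d
  fixed_iff : ∀ d, τ d = d ↔ vtx d ∈ U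

/-- The two colour classes of `c` are closed trails that respect the prescribed transitions
and visit each vertex of `U` exactly once. -/
structure IsHamColoring (ι τ : Perm D) (vtx : D → W) (U : Finset W) (c : D → Bool) : Prop where
  edge : ∀ d, c (ι d) = c d
  trans : ∀ d, c (τ d) = c d
  two : ∀ v ∈ U, ∀ b, ∃ d₁ d₂, d₁ ≠ d₂ ∧ ∀ d, vtx d = v ∧ c d = b ↔ d = d₁ ∨ d = d₂
  conn : ∀ A : Set D, (∀ d ∈ A, ι d ∈ A) → (∀ d ∈ A, τ d ∈ A) →
    (∀ d ∈ A, ∀ d', vtx d ∈ U → vtx d = vtx d' → c d = c d' → d' ∈ A) →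
    ∀ d ∈ A, ∀ d', c d = c d' → d' ∈ A

variable {ι τ : Perm D} {vtx : D → W} {U : Finset W} {c : D → Bool}

namespace IsHamColoring

theorem not (h : IsHamColoring ι τ vtx U c) : IsHamColoring ι τ vtx U (fun d => !c d) where
  edge d := by rw [h.edge]
  trans d := by rw [h.trans]
  two v hv b := by
    obtain ⟨d₁, d₂, h1, h2⟩ := h.two v hv (!b)
    refine ⟨d₁, d₂, h1, fun d => ?_⟩
    rw [← h2]
    cases b <;> simp
  conn A h1 h2 h3 d hd d' hdd' := by
    refine h.conn A h1 h2 ?_ d hd d' (by simpa using hdd')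
    intro e he e' heU hee' hc
    exact h3 e he e' heU hee' (by simp [hc])

theorem sameCycle (h : IsHamColoring ι τ vtx U c) [Finite D] {d e : D}
    (hde : (τ * ι).SameCycle d e) : c e = c d := by
  obtain ⟨i, rfl⟩ := hde.exists_nat_pow_eq
  induction i with
  | zero => rfl
  | succ i ih =>
    rw [pow_succ', Perm.mul_apply, Perm.mul_apply, h.trans, h.edge]
    exact ih ⟨i, rfl⟩

/-- A free vertex has degree four, as each colour contributes two darts. -/
theorem exists_darts (h : IsHamColoring ι τ vtx U c) {w : W} (hw : w ∈ U) {x y : D}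
    (hx : vtx x = w) (hy : vtx y = w) (hxy : c x ≠ c y) :
    ∃ z t, [x, y, z, t].Nodup ∧ (∀ d, vtx d = w ↔ d = x ∨ d = y ∨ d = z ∨ d = t) ∧
      c z = c x ∧ c t = c y := by
  obtain ⟨p₁, p₂, hp, hp'⟩ := h.two w hw (c x)
  obtain ⟨q₁, q₂, hq, hq'⟩ := h.two w hw (c y)
  have h1 : ∃ z, z ≠ x ∧ ∀ d, vtx d = w ∧ c d = c x ↔ d = x ∨ d = z := by
    rcases (hp' x).1 ⟨hx, rfl⟩ with h | h
    · exact ⟨p₂, by grind, by grind⟩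
    · exact ⟨p₁, by grind, by grind⟩
  have h2 : ∃ t, t ≠ y ∧ ∀ d, vtx d = w ∧ c d = c y ↔ d = y ∨ d = t := by
    rcases (hq' y).1 ⟨hy, rfl⟩ with h | h
    · exact ⟨q₂, by grind, by grind⟩
    · exact ⟨q₁, by grind, by grind⟩
  obtain ⟨z, hz, hz'⟩ := h1
  obtain ⟨t, ht, ht'⟩ := h2
  have hzc := ((hz' z).2 (Or.inr rfl))
  have htc := ((ht' t).2 (Or.inr rfl))
  refine ⟨z, t, ?_, ?_, hzc.2, htc.2⟩
  · grind
  · intro d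
    constructor
    · intro hd
      have : c d = c x ∨ c d = c y := by
        cases hcd : c d <;> cases hcx : c x <;> cases hcy : c y <;> simp_all
      grind
    · grind

theorem ne_of_darts (h : IsHamColoring ι τ vtx U c) {w : W} (hw : w ∈ U) {x y z t : D}
    (hnd : [x, y, z, t].Nodup) (hall : ∀ d, vtx d = w ↔ d = x ∨ d = y ∨ d = z ∨ d = t)
    (hxy : c x ≠ c y) : c z ≠ c t := by
  obtain ⟨p₁, p₂, hp, hp'⟩ := h.two w hw (c x)
  obtain ⟨q₁, q₂, hq, hq'⟩ := h.two w hw (c y)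
  intro hzt
  have : c z = c x ∨ c z = c y := by
    cases hcd : c z <;> cases hcx : c x <;> cases hcy : c y <;> simp_all
  grind

end IsHamColoring

theorem two_of_darts {w : W} {x y z t : D}
    (hnd : [x, y, z, t].Nodup) (hall : ∀ d, vtx d = w ↔ d = x ∨ d = y ∨ d = z ∨ d = t)
    (hxy : c x ≠ c y) (hzt : c z ≠ c t) (b : Bool) :
    ∃ d₁ d₂, d₁ ≠ d₂ ∧ ∀ d, vtx d = w ∧ c d = b ↔ d = d₁ ∨ d = d₂ := by
  have : (c z = c x ∧ c t = c y) ∨ (c z = c y ∧ c t = c x) := by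
    cases hcz : c z <;> cases hct : c t <;> cases hcx : c x <;> cases hcy : c y <;> simp_all
  have : c x = b ∨ c y = b := by
    cases hcb : b <;> cases hcx : c x <;> cases hcy : c y <;> simp_all
  simp only [List.nodup_cons, List.mem_cons, not_or] at hnd
  rcases this with rfl | rfl
  · by_cases h : c z = c x
    · exact ⟨x, z, by grind, by grind⟩
    · exact ⟨x, t, by grind, by grind⟩
  · by_cases h : c z = c y
    · exact ⟨y, z, by grind, by grind⟩
    · exact ⟨y, t, by grind, by grind⟩

end Coloring

end HLine

/-! ### Parity with two free vertices -/

namespace HLine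

open Equiv

variable {D : Type*} {W : Type*} {ι τ : Perm D} {vtx : D → W} {U : Finset W} {c : D → Bool}

/-- With two free vertices `w` and `u`, each dart at `w` starts a trail that ends at `u`. -/
theorem IsHamColoring.exists_opposite [Finite D] [DecidableEq W] {w u : W} (hwu : w ≠ u)
    (hT : IsTransition ι τ vtx {w, u}) (h : IsHamColoring ι τ vtx {w, u} c) {a : D}
    (ha : vtx a = w) :
    ∃ a', vtx a' = u ∧ c a' = c a ∧ (τ * ι).SameCycle a a' ∧
      ∀ d, (τ * ι).SameCycle a d → vtx d ∈ ({w, u} : Finset W) → d = a ∨ d = a' := by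
  have hfix : τ a = a := (hT.fixed_iff a).2 (by simp [ha])
  obtain ⟨a', hne, hfix', hcyc, huniq⟩ :=
    exists_unique_other_fixed hT.inv_edge hT.edge_ne hT.inv_trans hfix
  have hmem' := (hT.fixed_iff a').1 hfix'
  have huniq' : ∀ d, (τ * ι).SameCycle a d → vtx d ∈ ({w, u} : Finset W) → d = a ∨ d = a' :=
    fun d hd hdU => huniq d hd ((hT.fixed_iff d).2 hdU)
  have hc := h.sameCycle hcyc
  refine ⟨a', ?_, hc, hcyc, huniq'⟩
  by_contra hu
  have hw' : vtx a' = w := by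
    simp only [Finset.mem_insert, Finset.mem_singleton] at hmem'
    tauto
  obtain ⟨p₁, p₂, hp, hp'⟩ := h.two w (by simp) (c a)
  obtain ⟨q₁, q₂, hq, hq'⟩ := h.two u (by simp) (c a)
  have hq1 := (hq' q₁).2 (Or.inl rfl)
  -- If the trail returned to `w`, it would use both darts of its colour there. It would then be a
  -- full colour class that misses `u`.
  have hA := h.conn {d | (τ * ι).SameCycle a d}
    (fun d hd => sameCycle_involution_right hT.inv_edge hT.inv_trans hfix hd)
    (fun d hd => sameCycle_involution_left hT.inv_edge hT.inv_trans hfix hd)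
    (by
      intro d hd d' hdU hdd' hcd
      have h3 : d' = a ∨ d' = a' := by
        rcases huniq' d hd hdU with rfl | rfl <;> grind
      rcases h3 with rfl | rfl
      · exact Perm.SameCycle.refl _ _
      · exact hcyc)
    a (Perm.SameCycle.refl _ _) q₁ hq1.2.symm
  rcases huniq' q₁ hA (by simp [hq1.1]) with h4 | h4
  · exact hwu (by rw [← ha, ← h4, hq1.1])
  · exact hwu (by rw [← hw', ← h4, hq1.1])

open scoped Classical in
/-- Reversal of the colours on a set of darts. -/
noncomputable def flipOn (L : Set D) (c : D → Bool) (d : D) : Bool :=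
  if d ∈ L then !c d else c d

theorem flipOn_of_mem {L : Set D} {d : D} (h : d ∈ L) : flipOn L c d = !c d := if_pos h

theorem flipOn_of_notMem {L : Set D} {d : D} (h : d ∉ L) : flipOn L c d = c d := if_neg h

theorem flipOn_flipOn (L : Set D) (c : D → Bool) : flipOn L (flipOn L c) = c := by
  funext d
  by_cases h : d ∈ L
  · rw [flipOn_of_mem h, flipOn_of_mem h, Bool.not_not]
  · rw [flipOn_of_notMem h, flipOn_of_notMem h]

theorem flipOn_compl (L : Set D) (c : D → Bool) : flipOn Lᶜ c = fun d => !flipOn L c d := by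
  funext d
  by_cases h : d ∈ L
  · rw [flipOn_of_mem h, flipOn_of_notMem (by simpa using h), Bool.not_not]
  · rw [flipOn_of_notMem h, flipOn_of_mem (by simpa using h)]

theorem forall_dart_iff {u : W} {x y z t p q : D}
    (hall : ∀ d, vtx d = u ↔ d = x ∨ d = y ∨ d = p ∨ d = q) (hnd' : [x, y, z, t].Nodup)
    (hz : vtx z = u) (ht : vtx t = u) (d : D) :
    vtx d = u ↔ d = x ∨ d = y ∨ d = z ∨ d = t := by
  have h1 := hall d
  have h2 := (hall z).1 hz
  have h3 := (hall t).1 ht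
  clear hall
  grind

/-- The four trails from `w` meet `w` and `u` only in their end darts, so they are pairwise
different and use up the four darts at `u`. -/
theorem IsHamColoring.exists_opposite_darts [Finite D] [DecidableEq W] {w u : W} (hwu : w ≠ u)
    (hT : IsTransition ι τ vtx {w, u}) (h : IsHamColoring ι τ vtx {w, u} c) {x y z t : D}
    (hnd : [x, y, z, t].Nodup) (hall : ∀ d, vtx d = w ↔ d = x ∨ d = y ∨ d = z ∨ d = t)
    (hxy : c x ≠ c y) :
    ∃ x' y' z' t', [x', y', z', t'].Nodup ∧
      (∀ d, vtx d = u ↔ d = x' ∨ d = y' ∨ d = z' ∨ d = t') ∧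
      (τ * ι).SameCycle x x' ∧ (τ * ι).SameCycle y y' ∧
      (τ * ι).SameCycle z z' ∧ (τ * ι).SameCycle t t' ∧
      x ∉ {d | (τ * ι).SameCycle z d ∨ (τ * ι).SameCycle t d} ∧
      x' ∉ {d | (τ * ι).SameCycle z d ∨ (τ * ι).SameCycle t d} ∧
      y ∉ {d | (τ * ι).SameCycle z d ∨ (τ * ι).SameCycle t d} ∧
      y' ∉ {d | (τ * ι).SameCycle z d ∨ (τ * ι).SameCycle t d} := by
  set L := {d | (τ * ι).SameCycle z d ∨ (τ * ι).SameCycle t d} with hL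
  have hx : vtx x = w := by grind
  have hy : vtx y = w := by grind
  have hz : vtx z = w := by grind
  have ht : vtx t = w := by grind
  obtain ⟨x', hxu, hxc, hxs, hx'⟩ := h.exists_opposite hwu hT hx
  obtain ⟨y', hyu, hyc, hys, hy'⟩ := h.exists_opposite hwu hT hy
  obtain ⟨z', hzu, hzc, hzs, hz'⟩ := h.exists_opposite hwu hT hz
  obtain ⟨t', htu, htc, hts, ht'⟩ := h.exists_opposite hwu hT ht
  have huU : u ∈ ({w, u} : Finset W) := by simp
  simp only [List.nodup_cons, List.mem_cons, not_or, List.not_mem_nil, not_false_iff,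
    List.nodup_nil, and_true] at hnd
  -- trails from different darts at `w` are different
  have sep : ∀ {a a' b b' : D}, vtx a = w → vtx b = w → vtx b' = u → a ≠ b →
      (τ * ι).SameCycle b b' →
      (∀ d, (τ * ι).SameCycle a d → vtx d ∈ ({w, u} : Finset W) → d = a ∨ d = a') →
      vtx a' = u → ¬ (τ * ι).SameCycle a b ∧ ¬ (τ * ι).SameCycle a b' := by
    intro a a' b b' ha hb hb' hab hbb' huniq ha'
    have h1 : ¬ (τ * ι).SameCycle a b := by
      intro h1
      rcases huniq b h1 (by simp [hb]) with h2 | h2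
      · exact hab h2.symm
      · exact hwu (by rw [← hb, ← ha', h2])
    exact ⟨h1, fun h2 => h1 (h2.trans hbb'.symm)⟩
  have hxL : x ∉ L ∧ x' ∉ L := by
    have h1 := sep hz hx hxu (by tauto) hxs hz' hzu
    have h2 := sep ht hx hxu (by tauto) hxs ht' htu
    simp only [hL, Set.mem_ofPred_eq]
    tauto
  have hyL : y ∉ L ∧ y' ∉ L := by
    have h1 := sep hz hy hyu (by tauto) hys hz' hzu
    have h2 := sep ht hy hyu (by tauto) hys ht' htu
    simp only [hL, Set.mem_ofPred_eq]
    tauto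
  have hnd' : [x', y', z', t'].Nodup := by
    have ne : ∀ {a a' b b' : D}, vtx a = w → vtx b = w → vtx b' = u → a ≠ b →
        (τ * ι).SameCycle b b' → (τ * ι).SameCycle a a' →
        (∀ d, (τ * ι).SameCycle a d → vtx d ∈ ({w, u} : Finset W) → d = a ∨ d = a') →
        vtx a' = u → a' ≠ b' := by
      intro a a' b b' ha hb hb' hab hbb' haa' huniq ha' heq
      exact (sep ha hb hb' hab hbb' huniq ha').2 (heq ▸ haa')
    have h1 := ne hx hy hyu (by tauto) hys hxs hx' hxu
    have h2 := ne hx hz hzu (by tauto) hzs hxs hx' hxu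
    have h3 := ne hx ht htu (by tauto) hts hxs hx' hxu
    have h4 := ne hy hz hzu (by tauto) hzs hys hy' hyu
    have h5 := ne hy ht htu (by tauto) hts hys hy' hyu
    have h6 := ne hz ht htu (by tauto) hts hzs hz' hzu
    simp [h1, h2, h3, h4, h5, h6]
  have hall' : ∀ d, vtx d = u ↔ d = x' ∨ d = y' ∨ d = z' ∨ d = t' := by
    obtain ⟨p, q, -, hpall, -, -⟩ :=
      h.exists_darts huU hxu hyu (by rwa [hxc, hyc])
    exact forall_dart_iff hpall hnd' hzu htu
  exact ⟨x', y', z', t', hnd', hall', hxs, hys, hzs, hts, hxL.1, hxL.2, hyL.1, hyL.2⟩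

/-- The four trails from `w` contain every dart at `w` and `u`, so their union is closed under all
moves within a colour class; `x` and `y` represent both colours. -/
theorem IsHamColoring.exists_sameCycle [Finite D] [DecidableEq W] {w u : W} (hwu : w ≠ u)
    (hT : IsTransition ι τ vtx {w, u}) (h : IsHamColoring ι τ vtx {w, u} c) {x y z t : D}
    (hnd : [x, y, z, t].Nodup) (hall : ∀ d, vtx d = w ↔ d = x ∨ d = y ∨ d = z ∨ d = t)
    (hxy : c x ≠ c y) (d : D) : ∃ e, vtx e = w ∧ (τ * ι).SameCycle e d := by
  obtain ⟨x', y', z', t', hnd', hall', hxs, hys, hzs, hts, -⟩ :=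
    h.exists_opposite_darts hwu hT hnd hall hxy
  have hx : vtx x = w := (hall x).2 (by simp)
  have hy : vtx y = w := (hall y).2 (by simp)
  have hz : vtx z = w := (hall z).2 (by simp)
  have ht : vtx t = w := (hall t).2 (by simp)
  have hfix : ∀ {e}, vtx e = w → τ e = e := fun he => (hT.fixed_iff _).2 (by simp [he])
  have key : ∀ e, vtx e = w → ∀ d, c e = c d → ∃ e, vtx e = w ∧ (τ * ι).SameCycle e d := by
    intro e he
    refine h.conn {d | ∃ e, vtx e = w ∧ (τ * ι).SameCycle e d} ?_ ?_ ?_ e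
      ⟨e, he, Perm.SameCycle.refl _ _⟩
    · rintro d ⟨e, he, hd⟩
      exact ⟨e, he, sameCycle_involution_right hT.inv_edge hT.inv_trans (hfix he) hd⟩
    · rintro d ⟨e, he, hd⟩
      exact ⟨e, he, sameCycle_involution_left hT.inv_edge hT.inv_trans (hfix he) hd⟩
    · rintro d - d' hdU hdd' -
      rw [hdd'] at hdU
      simp only [Finset.mem_insert, Finset.mem_singleton] at hdU
      rcases hdU with h1 | h1
      · exact ⟨d', h1, Perm.SameCycle.refl _ _⟩
      · rcases (hall' d').1 h1 with rfl | rfl | rfl | rfl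
        · exact ⟨x, hx, hxs⟩
        · exact ⟨y, hy, hys⟩
        · exact ⟨z, hz, hzs⟩
        · exact ⟨t, ht, hts⟩
  rcases (show ∀ p q r : Bool, p ≠ q → p = r ∨ q = r by decide) _ _ (c d) hxy with h1 | h1
  · exact key x hx d h1
  · exact key y hy d h1
-- The trails of `z` and `t` have opposite colours, so exchanging these colours keeps two darts of
-- each colour at `w` and at `u`. Classes stay connected because every trail starts at `w`.
theorem IsHamColoring.flipOn [Finite D] [DecidableEq W] {w u : W} (hwu : w ≠ u)
    (hT : IsTransition ι τ vtx {w, u}) (h : IsHamColoring ι τ vtx {w, u} c) {x y z t : D}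
    (hnd : [x, y, z, t].Nodup) (hall : ∀ d, vtx d = w ↔ d = x ∨ d = y ∨ d = z ∨ d = t)
    (hxy : c x ≠ c y) :
    IsHamColoring ι τ vtx {w, u}
      (flipOn {d | (τ * ι).SameCycle z d ∨ (τ * ι).SameCycle t d} c) ∧
    x ∉ {d | (τ * ι).SameCycle z d ∨ (τ * ι).SameCycle t d} ∧
    y ∉ {d | (τ * ι).SameCycle z d ∨ (τ * ι).SameCycle t d} := by
  set L := {d | (τ * ι).SameCycle z d ∨ (τ * ι).SameCycle t d} with hL
  have hzt := h.ne_of_darts (by simp) hnd hall hxy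
  obtain ⟨x', y', z', t', hnd', hall', hxs, hys, hzs, hts, hxL, hxL', hyL, hyL'⟩ :=
    h.exists_opposite_darts hwu hT hnd hall hxy
  rw [← hL] at hxL hxL' hyL hyL'
  have hxc := h.sameCycle hxs
  have hyc := h.sameCycle hys
  have hzc := h.sameCycle hzs
  have htc := h.sameCycle hts
  have hz : vtx z = w := (hall z).2 (by simp)
  have ht : vtx t = w := (hall t).2 (by simp)
  have hfix : ∀ {e}, vtx e = w → τ e = e := fun he => (hT.fixed_iff _).2 (by simp [he])
  have hzL : z ∈ L ∧ z' ∈ L := ⟨Or.inl (Perm.SameCycle.refl _ _), Or.inl hzs⟩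
  have htL : t ∈ L ∧ t' ∈ L := ⟨Or.inr (Perm.SameCycle.refl _ _), Or.inr hts⟩
  have hcover := h.exists_sameCycle hwu hT hnd hall hxy
  have hLι : ∀ d, ι d ∈ L ↔ d ∈ L := by
    have : ∀ d, d ∈ L → ι d ∈ L := by
      rintro d (hd | hd)
      · exact Or.inl (sameCycle_involution_right hT.inv_edge hT.inv_trans (hfix hz) hd)
      · exact Or.inr (sameCycle_involution_right hT.inv_edge hT.inv_trans (hfix ht) hd)
    intro d
    exact ⟨fun hd => by simpa [hT.inv_edge] using this _ hd, this d⟩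
  have hLτ : ∀ d, τ d ∈ L ↔ d ∈ L := by
    have : ∀ d, d ∈ L → τ d ∈ L := by
      rintro d (hd | hd)
      · exact Or.inl (sameCycle_involution_left hT.inv_edge hT.inv_trans (hfix hz) hd)
      · exact Or.inr (sameCycle_involution_left hT.inv_edge hT.inv_trans (hfix ht) hd)
    intro d
    exact ⟨fun hd => by simpa [hT.inv_trans] using this _ hd, this d⟩
  have hfι : ∀ d, HLine.flipOn L c (ι d) = HLine.flipOn L c d := by
    intro d
    by_cases hd : d ∈ L
    · rw [flipOn_of_mem hd, flipOn_of_mem ((hLι d).2 hd), h.edge]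
    · rw [flipOn_of_notMem hd, flipOn_of_notMem (mt (hLι d).1 hd), h.edge]
  have hfτ : ∀ d, HLine.flipOn L c (τ d) = HLine.flipOn L c d := by
    intro d
    by_cases hd : d ∈ L
    · rw [flipOn_of_mem hd, flipOn_of_mem ((hLτ d).2 hd), h.trans]
    · rw [flipOn_of_notMem hd, flipOn_of_notMem (mt (hLτ d).1 hd), h.trans]
  refine ⟨⟨hfι, hfτ, ?_, ?_⟩, hxL, hyL⟩
  · intro v hv
    simp only [Finset.mem_insert, Finset.mem_singleton] at hv
    rcases hv with rfl | rfl
    · refine two_of_darts hnd hall ?_ ?_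
      · rwa [flipOn_of_notMem hxL, flipOn_of_notMem hyL]
      · rw [flipOn_of_mem hzL.1, flipOn_of_mem htL.1]
        simpa using hzt
    · refine two_of_darts hnd' hall' ?_ ?_
      · rwa [flipOn_of_notMem hxL', flipOn_of_notMem hyL', hxc, hyc]
      · rw [flipOn_of_mem hzL.2, flipOn_of_mem htL.2, hzc, htc]
        simpa using hzt
  · intro A hAι hAτ hAv a ha b hab
    have hAcyc : ∀ d ∈ A, ∀ e, (τ * ι).SameCycle d e → e ∈ A := by
      intro d hd e hde
      obtain ⟨i, rfl⟩ := hde.exists_nat_pow_eq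
      clear hde
      induction i with
      | zero => exact hd
      | succ i ih =>
        rw [pow_succ', Perm.mul_apply, Perm.mul_apply]
        exact hAτ _ (hAι _ ih)
    have hfcyc : ∀ d e, (τ * ι).SameCycle d e → HLine.flipOn L c e = HLine.flipOn L c d := by
      intro d e hde
      obtain ⟨i, rfl⟩ := hde.exists_nat_pow_eq
      clear hde
      induction i with
      | zero => rfl
      | succ i ih => rw [pow_succ', Perm.mul_apply, Perm.mul_apply, hfτ, hfι, ih]
    obtain ⟨e, he, hea⟩ := hcover a
    obtain ⟨f, hf, hfb⟩ := hcover b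
    have he' : e ∈ A := hAcyc a ha e hea.symm
    refine hAcyc f (hAv e he' f (by simp [he]) (by rw [he, hf]) ?_) b hfb
    rw [← hfcyc e a hea, ← hfcyc f b hfb, hab]

open scoped Classical in
/-- The Hamiltonian colourings in which `d₀` has the first colour and `x`, `y` differ in colour. -/
noncomputable def hamColorings [Fintype D] (ι τ : Perm D) (vtx : D → W) (U : Finset W)
    (d₀ x y : D) : Finset (D → Bool) :=
  {c | IsHamColoring ι τ vtx U c ∧ c d₀ = false ∧ c x ≠ c y}

theorem mem_hamColorings [Fintype D] {d₀ x y : D} :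
    c ∈ hamColorings ι τ vtx U d₀ x y ↔ IsHamColoring ι τ vtx U c ∧ c d₀ = false ∧ c x ≠ c y := by
  simp [hamColorings]

/-- Flipping the trails of `z` and `t` is a fixed-point-free involution on these colourings. The
trails depend on `τ` and `ι` only, so one flip serves all colourings. -/
theorem even_card_hamColorings_pair [Fintype D] [DecidableEq W] {w u : W} (hwu : w ≠ u)
    (hT : IsTransition ι τ vtx {w, u}) (d₀ : D) {x y : D} (hx : vtx x = w) (hy : vtx y = w) :
    Even (hamColorings ι τ vtx {w, u} d₀ x y).card := by
  rcases (hamColorings ι τ vtx {w, u} d₀ x y).eq_empty_or_nonempty with h | ⟨c₀, h⟩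
  · simp [h]
  obtain ⟨h0, -, hxy0⟩ := mem_hamColorings.1 h
  obtain ⟨z, t, hnd, hall, -, -⟩ := h0.exists_darts (by simp) hx hy hxy0
  set L := {d | (τ * ι).SameCycle z d ∨ (τ * ι).SameCycle t d} with hL
  -- If `d₀` lies on a flipped trail, the complement is flipped instead; this differs by a global
  -- exchange of colours and preserves `c d₀ = false`.
  have hstep : ∃ M : Set D, d₀ ∉ M ∧ ((x ∈ M ∧ y ∈ M) ∨ (x ∉ M ∧ y ∉ M)) ∧ M.Nonempty ∧
      ∀ c, IsHamColoring ι τ vtx {w, u} c → c x ≠ c y →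
        IsHamColoring ι τ vtx {w, u} (flipOn M c) := by
    obtain ⟨-, hxL, hyL⟩ := h0.flipOn hwu hT hnd hall hxy0
    by_cases hd : d₀ ∈ L
    · refine ⟨Lᶜ, by simpa using hd, Or.inl ⟨hxL, hyL⟩, ⟨x, hxL⟩, ?_⟩
      intro c hc hxy
      rw [flipOn_compl]
      exact (hc.flipOn hwu hT hnd hall hxy).1.not
    · exact ⟨L, hd, Or.inr ⟨hxL, hyL⟩, ⟨z, Or.inl (Perm.SameCycle.refl _ _)⟩,
        fun c hc hxy => (hc.flipOn hwu hT hnd hall hxy).1⟩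
  obtain ⟨M, hd, hxyM, ⟨m, hm⟩, hM⟩ := hstep
  refine even_card_of_involution _ (flipOn M) ?_ ?_ ?_
  · intro c hc
    obtain ⟨h1, h2, h3⟩ := mem_hamColorings.1 hc
    refine mem_hamColorings.2 ⟨hM c h1 h3, ?_, ?_⟩
    · rwa [flipOn_of_notMem hd]
    · rcases hxyM with ⟨h4, h5⟩ | ⟨h4, h5⟩
      · rw [flipOn_of_mem h4, flipOn_of_mem h5]
        simpa using h3
      · rwa [flipOn_of_notMem h4, flipOn_of_notMem h5]
  · intro c _ h1
    have := congrFun h1 m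
    rw [flipOn_of_mem hm] at this
    simp at this
  · intro c _
    exact flipOn_flipOn M c

end HLine

/-! ### Splitting a free vertex and Thomason's parity theorem -/

namespace HLine

open Equiv

variable {D : Type*} {W : Type*} {ι τ τ' : Perm D} {vtx : D → W} {U : Finset W} {c : D → Bool}

/-- Splitting of the free vertex `w` by joining its darts `x`, `z` and `y`, `t`. -/
theorem isHamColoring_split_iff [DecidableEq W] (hT : IsTransition ι τ vtx U) {w : W} (hw : w ∈ U)
    {x y z t : D} (hnd : [x, y, z, t].Nodup)
    (hall : ∀ d, vtx d = w ↔ d = x ∨ d = y ∨ d = z ∨ d = t)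
    (hx : τ' x = z) (hz : τ' z = x) (hy : τ' y = t) (ht : τ' t = y)
    (hother : ∀ d, vtx d ≠ w → τ' d = τ d) (hxy : c x ≠ c y) :
    IsHamColoring ι τ' vtx (U.erase w) c ↔ IsHamColoring ι τ vtx U c ∧ c z = c x := by
  have hfix : ∀ d, vtx d = w → τ d = d := fun d hd => (hT.fixed_iff d).2 (by rwa [hd])
  have hpair : c z = c x → c t = c y → ∀ d, vtx d = w → ∀ d', vtx d' = w → c d = c d' →
      d' = d ∨ d' = τ' d := by
    intro hzx hty d hd d' hd' hdd'
    rcases (hall d).1 hd with rfl | rfl | rfl | rfl <;>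
      rcases (hall d').1 hd' with rfl | rfl | rfl | rfl <;> grind
  have hcol : c z = c x → c t = c y → ∀ d, vtx d = w → c (τ' d) = c d ∧ vtx (τ' d) = w := by
    intro hzx hty d hd
    have h1 := (hall x).2 (by simp)
    have h2 := (hall y).2 (by simp)
    have h3 := (hall z).2 (by simp)
    have h4 := (hall t).2 (by simp)
    rcases (hall d).1 hd with rfl | rfl | rfl | rfl
    · rw [hx]; exact ⟨hzx, h3⟩
    · rw [hy]; exact ⟨hty, h4⟩
    · rw [hz]; exact ⟨hzx.symm, h1⟩
    · rw [ht]; exact ⟨hty.symm, h2⟩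
  constructor
  · intro h
    have hzx : c z = c x := by rw [← hx, h.trans]
    have hty : c t = c y := by rw [← hy, h.trans]
    refine ⟨⟨h.edge, ?_, ?_, ?_⟩, hzx⟩
    · intro d
      by_cases hd : vtx d = w
      · rw [hfix d hd]
      · rw [← hother d hd, h.trans]
    · intro v hv b
      by_cases hvw : v = w
      · subst hvw
        exact two_of_darts hnd hall hxy (by rwa [hzx, hty]) b
      · exact h.two v (Finset.mem_erase.2 ⟨hvw, hv⟩) b
    · intro A h1 h2 h3
      refine h.conn A h1 ?_ ?_
      · intro d hd
        by_cases hdw : vtx d = w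
        · obtain ⟨h4, h5⟩ := hcol hzx hty d hdw
          exact h3 d hd _ (by rwa [hdw]) (by rw [hdw, h5]) h4.symm
        · rw [hother d hdw]
          exact h2 d hd
      · intro d hd d' hdU hdd' hc
        exact h3 d hd d' (Finset.mem_of_mem_erase hdU) hdd' hc
  · rintro ⟨h, hzx⟩
    have hty : c t = c y := by
      have := h.ne_of_darts hw hnd hall hxy
      rw [hzx] at this
      exact (show ∀ p q r : Bool, p ≠ q → p ≠ r → r = q by decide) _ _ _ hxy this
    refine ⟨h.edge, ?_, ?_, ?_⟩
    · intro d
      by_cases hd : vtx d = w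
      · exact (hcol hzx hty d hd).1
      · rw [hother d hd, h.trans]
    · intro v hv b
      exact h.two v (Finset.mem_of_mem_erase hv) b
    · intro A h1 h2 h3
      refine h.conn A h1 ?_ ?_
      · intro d hd
        by_cases hdw : vtx d = w
        · rwa [hfix d hdw]
        · rw [← hother d hdw]
          exact h2 d hd
      · intro d hd d' hdU hdd' hc
        by_cases hdw : vtx d = w
        · rcases hpair hzx hty d hdw d' (by rw [← hdd', hdw]) hc with rfl | rfl
          · exact hd
          · exact h2 d hd
        · exact h3 d hd d' (Finset.mem_erase.2 ⟨hdw, hdU⟩) hdd' hc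

theorem IsTransition.exists_split [DecidableEq W] (hT : IsTransition ι τ vtx U) {w : W}
    (hw : w ∈ U) {x y z t : D} (hnd : [x, y, z, t].Nodup)
    (hall : ∀ d, vtx d = w ↔ d = x ∨ d = y ∨ d = z ∨ d = t) :
    ∃ τ' : Perm D, IsTransition ι τ' vtx (U.erase w) ∧ τ' x = z ∧ τ' z = x ∧ τ' y = t ∧ τ' t = y ∧
      ∀ d, vtx d ≠ w → τ' d = τ d := by
  classical
  simp only [List.nodup_cons, List.mem_cons, not_or, List.not_mem_nil, not_false_iff,
    List.nodup_nil, and_true] at hnd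
  obtain ⟨⟨hxy, hxz, hxt⟩, ⟨hyz, hyt⟩, hzt⟩ := hnd
  have hfix : ∀ d, vtx d = w → τ d = d := fun d hd => (hT.fixed_iff d).2 (by rwa [hd])
  have fx := hfix x ((hall x).2 (by simp))
  have fy := hfix y ((hall y).2 (by simp))
  have fz := hfix z ((hall z).2 (by simp))
  have ft := hfix t ((hall t).2 (by simp))
  set τ' : Perm D := τ * swap x z * swap y t with hτ'
  have ex : τ' x = z := by
    simp [hτ', swap_apply_of_ne_of_ne hxy hxt, fz]
  have ez : τ' z = x := by
    simp [hτ', swap_apply_of_ne_of_ne (Ne.symm hyz) hzt, fx]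
  have ey : τ' y = t := by
    simp [hτ', swap_apply_of_ne_of_ne (Ne.symm hxt) (Ne.symm hzt), ft]
  have et : τ' t = y := by
    simp [hτ', swap_apply_of_ne_of_ne (Ne.symm hxy) hyz, fy]
  have eo : ∀ d, vtx d ≠ w → τ' d = τ d := by
    intro d hd
    rw [ne_eq, hall d] at hd
    simp only [not_or] at hd
    simp [hτ', swap_apply_of_ne_of_ne hd.2.1 hd.2.2.2, swap_apply_of_ne_of_ne hd.1 hd.2.2.1]
  refine ⟨τ', ⟨hT.inv_edge, hT.edge_ne, ?_, ?_⟩, ex, ez, ey, et, eo⟩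
  · intro d
    by_cases hd : vtx d = w
    · rcases (hall d).1 hd with rfl | rfl | rfl | rfl
      · rw [ex, ez]
      · rw [ey, et]
      · rw [ez, ex]
      · rw [et, ey]
    · have hτd : vtx (τ d) ≠ w := by
        intro h1
        have h2 := hfix _ h1
        rw [hT.inv_trans] at h2
        rw [← h2] at h1
        exact hd h1
      rw [eo d hd, eo _ hτd, hT.inv_trans]
  · intro d
    by_cases hd : vtx d = w
    · have : τ' d ≠ d := by
        rcases (hall d).1 hd with rfl | rfl | rfl | rfl
        · rw [ex]; exact Ne.symm hxz
        · rw [ey]; exact Ne.symm hyt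
        · rw [ez]; exact hxz
        · rw [et]; exact hyt
      simp [this, hd]
    · rw [eo d hd, hT.fixed_iff, Finset.mem_erase]
      tauto

/-- With two colours, the set for `x, z` is the symmetric difference of the sets for `x, y` and `y,
z`. -/
theorem even_card_hamColorings_trans [Fintype D] {d₀ x y z : D}
    (h1 : Even (hamColorings ι τ vtx U d₀ x y).card)
    (h2 : Even (hamColorings ι τ vtx U d₀ y z).card) :
    Even (hamColorings ι τ vtx U d₀ x z).card := by
  classical
  have h3 : hamColorings ι τ vtx U d₀ x z =
      (hamColorings ι τ vtx U d₀ x y \ hamColorings ι τ vtx U d₀ y z) ∪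
        (hamColorings ι τ vtx U d₀ y z \ hamColorings ι τ vtx U d₀ x y) := by
    ext c
    simp only [Finset.mem_union, Finset.mem_sdiff, mem_hamColorings]
    have := (show ∀ p q r : Bool, p ≠ r ↔ ((p ≠ q ∧ ¬ q ≠ r) ∨ (q ≠ r ∧ ¬ p ≠ q)) by decide)
      (c x) (c y) (c z)
    tauto
  rw [h3, Finset.card_union_of_disjoint disjoint_sdiff_sdiff]
  have h4 := Finset.card_sdiff_add_card_inter (hamColorings ι τ vtx U d₀ x y)
    (hamColorings ι τ vtx U d₀ y z)
  have h5 := Finset.card_sdiff_add_card_inter (hamColorings ι τ vtx U d₀ y z)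
    (hamColorings ι τ vtx U d₀ x y)
  rw [Finset.inter_comm] at h5
  rw [Nat.even_iff] at *
  omega

/-- Reduction to two darts at a common free vertex. Evenness is transitive, so it propagates from
`x` and from `y` along a colour class of one fixed colouring until both arrive at `v`. -/
theorem even_card_hamColorings_of_vertex [Fintype D] {d₀ : D} {v : W} (hv : v ∈ U)
    (h : ∀ w ∈ U, ∀ x y, vtx x = w → vtx y = w → Even (hamColorings ι τ vtx U d₀ x y).card)
    (x y : D) : Even (hamColorings ι τ vtx U d₀ x y).card := by
  rcases (hamColorings ι τ vtx U d₀ x y).eq_empty_or_nonempty with h0 | ⟨c, h0⟩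
  · simp [h0]
  obtain ⟨hc, -, -⟩ := mem_hamColorings.1 h0
  -- No colouring separates `d` from `σ d`, so the set counted is empty.
  have hinv : ∀ σ : Perm D, (∀ c, IsHamColoring ι τ vtx U c → ∀ d, c (σ d) = c d) → ∀ d,
      Even (hamColorings ι τ vtx U d₀ d (σ d)).card := by
    intro σ hσ d
    suffices hamColorings ι τ vtx U d₀ d (σ d) = ∅ by simp [this]
    rw [Finset.eq_empty_iff_forall_notMem]
    intro c hc
    obtain ⟨h1, -, h2⟩ := mem_hamColorings.1 hc
    exact h2 (hσ c h1 d).symm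
  have key : ∀ x, ∃ x', vtx x' = v ∧ Even (hamColorings ι τ vtx U d₀ x x').card := by
    intro x
    obtain ⟨x', _, -, hx'⟩ := hc.two v hv (c x)
    obtain ⟨h1, h2⟩ := (hx' x').2 (Or.inl rfl)
    refine ⟨x', h1, ?_⟩
    refine hc.conn {d | Even (hamColorings ι τ vtx U d₀ x d).card} ?_ ?_ ?_ x ?_ x' h2.symm
    · exact fun d hd => even_card_hamColorings_trans hd (hinv ι (fun c hc => hc.edge) d)
    · exact fun d hd => even_card_hamColorings_trans hd (hinv τ (fun c hc => hc.trans) d)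
    · exact fun d hd d' hdU hdd' _ => even_card_hamColorings_trans hd (h _ hdU d d' rfl hdd'.symm)
    · exact hinv 1 (fun _ _ _ => rfl) x
  have hsymm : ∀ a b, Even (hamColorings ι τ vtx U d₀ a b).card →
      Even (hamColorings ι τ vtx U d₀ b a).card := by
    intro a b hab
    convert hab using 2
    ext c
    simp only [mem_hamColorings, ne_comm]
  obtain ⟨x', hx, hx'⟩ := key x
  obtain ⟨y', hy, hy'⟩ := key y
  exact even_card_hamColorings_trans (even_card_hamColorings_trans hx' (h v hv x' y' hx hy))
    (hsymm _ _ hy')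

/-- Thomason's parity theorem: if there are at least two free vertices, then the number of
Hamiltonian colourings in which `x` and `y` differ in colour is even. -/
theorem even_card_hamColorings [Fintype D] [DecidableEq W] (k : ℕ) :
    ∀ (U : Finset W) (τ : Perm D), IsTransition ι τ vtx U → U.card = k + 2 → ∀ d₀ x y : D,
      Even (hamColorings ι τ vtx U d₀ x y).card := by
  induction k with
  | zero =>
    intro U τ hT hU d₀
    obtain ⟨w, u, hwu, rfl⟩ := Finset.card_eq_two.1 hU
    refine even_card_hamColorings_of_vertex (v := w) (by simp) ?_
    intro v hv x y hx hy
    simp only [Finset.mem_insert, Finset.mem_singleton] at hv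
    rcases hv with rfl | rfl
    · exact even_card_hamColorings_pair hwu hT d₀ hx hy
    · rw [Finset.pair_comm] at hT ⊢
      exact even_card_hamColorings_pair hwu.symm hT d₀ hx hy
  | succ k ih =>
    intro U τ hT hU d₀
    obtain ⟨v, hv⟩ : U.Nonempty := Finset.card_pos.1 (by omega)
    refine even_card_hamColorings_of_vertex hv ?_
    intro w hw x y hx hy
    rcases (hamColorings ι τ vtx U d₀ x y).eq_empty_or_nonempty with h0 | ⟨c₀, h0⟩
    · simp [h0]
    obtain ⟨hc₀, -, hxy₀⟩ := mem_hamColorings.1 h0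
    obtain ⟨z, t, hnd, hall, -, -⟩ := hc₀.exists_darts hw hx hy hxy₀
    have hnd' : [x, y, t, z].Nodup := by
      simp only [List.nodup_cons, List.mem_cons, not_or, List.not_mem_nil, not_false_iff,
        List.nodup_nil, and_true] at hnd ⊢
      tauto
    have hall' : ∀ d, vtx d = w ↔ d = x ∨ d = y ∨ d = t ∨ d = z := by
      intro d
      rw [hall d]
      tauto
    obtain ⟨τ₁, hT₁, h1x, h1z, h1y, h1t, h1⟩ := hT.exists_split hw hnd hall
    obtain ⟨τ₂, hT₂, h2x, h2t, h2y, h2z, h2⟩ := hT.exists_split hw hnd' hall'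
    have hcard : (U.erase w).card = k + 2 := by
      rw [Finset.card_erase_of_mem hw]
      omega
    classical
    -- Exactly one of `z`, `t` has the colour of `x`. Joining it to `x`, and the other one to `y`,
    -- leaves one free vertex fewer.
    have hunion : hamColorings ι τ vtx U d₀ x y =
        hamColorings ι τ₁ vtx (U.erase w) d₀ x y ∪ hamColorings ι τ₂ vtx (U.erase w) d₀ x y := by
      ext c
      simp only [Finset.mem_union, mem_hamColorings]
      by_cases hxy : c x = c y
      · simp [hxy]
      · rw [isHamColoring_split_iff hT hw hnd hall h1x h1z h1y h1t h1 hxy,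
          isHamColoring_split_iff hT hw hnd' hall' h2x h2t h2y h2z h2 hxy]
        constructor
        · rintro ⟨hc, h3, h4⟩
          have h5 := hc.ne_of_darts hw hnd hall hxy
          rcases (show ∀ p q r : Bool, p ≠ q → p = r ∨ q = r by decide) _ _ (c x) h5 with h6 | h6
          · exact Or.inl ⟨⟨hc, h6⟩, h3, h4⟩
          · exact Or.inr ⟨⟨hc, h6⟩, h3, h4⟩
        · rintro (⟨⟨hc, -⟩, h3, h4⟩ | ⟨⟨hc, -⟩, h3, h4⟩) <;> exact ⟨hc, h3, h4⟩
    have hdisj : Disjoint (hamColorings ι τ₁ vtx (U.erase w) d₀ x y)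
        (hamColorings ι τ₂ vtx (U.erase w) d₀ x y) := by
      rw [Finset.disjoint_left]
      intro c hc1 hc2
      obtain ⟨h3, -, hxy⟩ := mem_hamColorings.1 hc1
      obtain ⟨h4, -, -⟩ := mem_hamColorings.1 hc2
      have h5 := (isHamColoring_split_iff hT hw hnd hall h1x h1z h1y h1t h1 hxy).1 h3
      have h6 := (isHamColoring_split_iff hT hw hnd' hall' h2x h2t h2y h2z h2 hxy).1 h4
      exact h5.1.ne_of_darts hw hnd hall hxy (h5.2.trans h6.2.symm)
    rw [hunion, Finset.card_union_of_disjoint hdisj]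
    exact (ih _ _ hT₁ hcard d₀ x y).add (ih _ _ hT₂ hcard d₀ x y)

end HLine

namespace HLine

open Equiv

universe u

/-! ### A second colouring, and colour classes as trails and paths -/

section Abstract

variable {D : Type*} {W : Type*} {ι τ : Perm D} {vtx : D → W} {U : Finset W} {c c' : D → Bool}

/-- Thomason's theorem: a Hamiltonian colouring is never the only one. -/
theorem IsHamColoring.exists_other [Fintype D] [DecidableEq W] (hT : IsTransition ι τ vtx U)
    (hU : 2 ≤ U.card) (h : IsHamColoring ι τ vtx U c) {x y : D} (hx : c x = false)
    (hy : c y = true) :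
    ∃ c', IsHamColoring ι τ vtx U c' ∧ c' ≠ c ∧ c' x = false ∧ c' y = true := by
  obtain ⟨k, hk⟩ := Nat.exists_eq_add_of_le hU
  -- With `d₀ = x` each decomposition is counted once rather than twice, so evenness yields a
  -- genuinely different one.
  have heven := even_card_hamColorings k U τ hT (by omega) x x y
  have hmem : c ∈ hamColorings ι τ vtx U x x y := mem_hamColorings.2 ⟨h, hx, by simp [hx, hy]⟩
  have hlt : 1 < (hamColorings ι τ vtx U x x y).card := by
    have := Finset.card_pos.2 ⟨c, hmem⟩
    rw [Nat.even_iff] at heven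
    omega
  obtain ⟨c', hc', hne⟩ := Finset.exists_mem_ne hlt c
  obtain ⟨h1, h2, h3⟩ := mem_hamColorings.1 hc'
  refine ⟨c', h1, hne, h2, ?_⟩
  simpa [h2] using h3

/-- Both classes have two darts at each free vertex, so the smaller class is closed under the moves
of the larger one, which is connected. -/
theorem IsHamColoring.class_eq_of_subset (h : IsHamColoring ι τ vtx U c)
    (h' : IsHamColoring ι τ vtx U c') {b : Bool} (hsub : ∀ d, c' d = b → c d = b) {x : D}
    (hx : c' x = b) : c' = c := by
  have key : ∀ d, c d = b → c' d = b := by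
    intro d hd
    refine h.conn {d | c' d = b} ?_ ?_ ?_ x hx d (by rw [hsub x hx, hd])
    · exact fun d hd => (h'.edge d).trans hd
    · exact fun d hd => (h'.trans d).trans hd
    · intro d hd d' hdU hdd' hc
      obtain ⟨e₁, e₂, he, hall⟩ := h.two _ hdU b
      obtain ⟨f₁, f₂, hf, hall'⟩ := h'.two _ hdU b
      have h1 := (hall' f₁).2 (Or.inl rfl)
      have h2 := (hall' f₂).2 (Or.inr rfl)
      have h3 := (hall f₁).1 ⟨h1.1, hsub _ h1.2⟩
      have h4 := (hall f₂).1 ⟨h2.1, hsub _ h2.2⟩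
      have h5 := (hall d').1 ⟨hdd'.symm, by rw [← hc]; exact hsub d hd⟩
      change c' d' = b
      grind
  funext d
  have h1 := hsub d
  have h2 := key d
  exact (show ∀ p q b : Bool, (p = b → q = b) → (q = b → p = b) → p = q by decide) _ _ b h1 h2

/-- The transition from dart to dart along the colour classes. -/
theorem IsHamColoring.exists_transition (hT : IsTransition ι τ vtx U)
    (hτ : ∀ d, vtx (τ d) = vtx d)
    (hpair : ∀ d d', vtx d = vtx d' → vtx d ∉ U → d' = d ∨ d' = τ d)
    (h : IsHamColoring ι τ vtx U c) :
    ∃ σ : Perm D, (∀ d, σ (σ d) = d) ∧ (∀ d, σ d ≠ d) ∧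
      ∀ d e, vtx e = vtx d ∧ c e = c d ↔ e = d ∨ e = σ d := by
  have hex : ∀ d, ∃ d', d' ≠ d ∧ ∀ e, vtx e = vtx d ∧ c e = c d ↔ e = d ∨ e = d' := by
    intro d
    by_cases hd : vtx d ∈ U
    · obtain ⟨e₁, e₂, he, hall⟩ := h.two _ hd (c d)
      rcases (hall d).1 ⟨rfl, rfl⟩ with h1 | h1
      · exact ⟨e₂, by grind, by grind⟩
      · exact ⟨e₁, by grind, by grind⟩
    · refine ⟨τ d, mt (hT.fixed_iff d).1 hd, fun e => ⟨?_, ?_⟩⟩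
      · rintro ⟨h1, -⟩
        exact hpair d e h1.symm hd
      · rintro (rfl | rfl)
        · exact ⟨rfl, rfl⟩
        · exact ⟨hτ d, h.trans d⟩
  choose σ hne hσ using hex
  have hinv : Function.Involutive σ := by
    intro d
    have h1 := (hσ d (σ d)).2 (Or.inr rfl)
    have h2 := (hσ (σ d) (σ (σ d))).2 (Or.inr rfl)
    rcases (hσ d (σ (σ d))).1 ⟨h2.1.trans h1.1, h2.2.trans h1.2⟩ with h3 | h3
    · exact h3
    · exact (hne _ h3).elim
  exact ⟨hinv.toPerm, hinv, hne, hσ⟩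

/-- A colour class is traversed by a closed trail that starts at a given dart. -/
theorem IsHamColoring.exists_trail [Finite D] (hT : IsTransition ι τ vtx U)
    (hτ : ∀ d, vtx (τ d) = vtx d)
    (hpair : ∀ d d', vtx d = vtx d' → vtx d ∉ U → d' = d ∨ d' = τ d)
    (h : IsHamColoring ι τ vtx U c) (a : D) :
    ∃ (m : ℕ) (s : ℕ → D), 0 < m ∧ s 0 = a ∧ s m = a ∧
      (∀ k, vtx (ι (s k)) = vtx (s (k + 1))) ∧ (∀ k, ι (s k) ≠ s (k + 1)) ∧
      (∀ j k, j < m → k < m → vtx (s j) = vtx (s k) → j = k) ∧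
      ∀ d, c d = c a → ∃ k < m, d = s k ∨ d = ι (s k) := by
  obtain ⟨σ, hσ, hne, hall⟩ := h.exists_transition hT hτ hpair
  set ρ := σ * ι with hρ
  have hper : ∀ k : ℤ, (ρ ^ k) a = a ↔ (MulAction.period ρ a : ℤ) ∣ k := fun k => by
    rw [← Perm.smul_def]
    exact MulAction.zpow_smul_eq_iff_period_dvd
  have hpos : 0 < MulAction.period ρ a :=
    MulAction.period_pos_of_orderOf_pos (orderOf_pos ρ) a
  set m := MulAction.period ρ a
  -- The trail never runs backwards: halving `i` would give a fixed point of `σ` for even `i` and of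
  -- `ι` for odd `i`.
  have hrev : ∀ i : ℤ, (ρ ^ i) a ≠ σ a := by
    intro i hi
    rcases Int.even_or_odd' i with ⟨l, rfl | rfl⟩
    · apply hne ((ρ ^ l) a)
      rw [zpow_mul_involutive hT.inv_edge hσ, ← hi, ← Perm.mul_apply, ← zpow_add]
      congr 2
      ring
    · have h1 : σ ((ρ ^ (l + 1)) a) = (ρ ^ l) a := by
        rw [zpow_mul_involutive hT.inv_edge hσ, ← hi, ← Perm.mul_apply, ← zpow_add]
        congr 2
        ring
      rw [add_comm, zpow_add, zpow_one, Perm.mul_apply, hρ, Perm.mul_apply, hσ] at h1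
      exact hT.edge_ne _ h1
  have hsucc : ∀ k : ℕ, (ρ ^ (k + 1)) a = σ (ι ((ρ ^ k) a)) := by
    intro k
    rw [pow_succ', Perm.mul_apply, hρ, Perm.mul_apply]
  have hcol : ∀ k : ℕ, c ((ρ ^ k) a) = c a := by
    intro k
    induction k with
    | zero => rfl
    | succ k ih =>
      rw [hsucc, ((hall _ _).2 (Or.inr rfl)).2, h.edge, ih]
  have hm : (ρ ^ m) a = a := by
    have := (hper m).2 dvd_rfl
    rwa [zpow_natCast] at this
  refine ⟨m, fun k => (ρ ^ k) a, hpos, rfl, hm, ?_, ?_, ?_, ?_⟩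
  · intro k
    simp only [hsucc]
    exact ((hall _ _).2 (Or.inr rfl)).1.symm
  · intro k
    simp only [hsucc]
    exact (hne _).symm
  · intro j k hj hk hjk
    rcases (hall _ _).1 ⟨hjk, (hcol j).trans (hcol k).symm⟩ with h1 | h1 <;> beta_reduce at h1
    · have h2 : (ρ ^ ((j : ℤ) - k)) a = a := by
        rw [sub_eq_neg_add, zpow_add, Perm.mul_apply, zpow_natCast, h1, ← zpow_natCast,
          ← Perm.mul_apply, ← zpow_add, neg_add_cancel, zpow_zero, Perm.one_apply]
      obtain ⟨r, hr⟩ := (hper _).1 h2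
      have h3 : (j : ℤ) - k = 0 := by
        apply Int.eq_zero_of_abs_lt_dvd ⟨r, hr⟩
        rw [abs_lt]
        omega
      omega
    · exfalso
      rw [← zpow_natCast ρ k, zpow_mul_involutive hT.inv_edge hσ, zpow_neg, Perm.eq_inv_iff_eq,
        ← zpow_natCast, ← Perm.mul_apply, ← zpow_add] at h1
      exact hrev _ h1
  · have hmod : ∀ k : ℕ, (ρ ^ k) a = (ρ ^ (k % m)) a := by
      intro k
      conv_lhs => rw [← Nat.mod_add_div k m, pow_add, Perm.mul_apply]
      congr 1
      rw [← zpow_natCast, hper]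
      exact ⟨(k / m : ℕ), by push_cast; ring⟩
    have hclosed : ∀ d, (∃ k : ℕ, d = (ρ ^ k) a ∨ d = ι ((ρ ^ k) a)) → ∀ e,
        vtx e = vtx d ∧ c e = c d → ∃ k : ℕ, e = (ρ ^ k) a ∨ e = ι ((ρ ^ k) a) := by
      rintro d ⟨k, hk⟩ e hed
      rcases (hall d e).1 hed with rfl | rfl
      · exact ⟨k, hk⟩
      · rcases hk with rfl | rfl
        · refine ⟨k + m - 1, Or.inr ?_⟩
          have h1 := hsucc (k + m - 1)
          rw [show k + m - 1 + 1 = k + m by omega, pow_add, Perm.mul_apply, hm] at h1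
          rw [h1, hσ]
        · exact ⟨k + 1, Or.inl (hsucc k).symm⟩
    intro d hd
    have h1 : ∃ k : ℕ, d = (ρ ^ k) a ∨ d = ι ((ρ ^ k) a) := by
      refine h.conn {d | ∃ k : ℕ, d = (ρ ^ k) a ∨ d = ι ((ρ ^ k) a)} ?_ ?_ ?_ a
        ⟨0, Or.inl rfl⟩ d hd.symm
      · rintro d ⟨k, rfl | rfl⟩
        · exact ⟨k, Or.inr rfl⟩
        · exact ⟨k, Or.inl (hT.inv_edge _)⟩
      · exact fun d hd => hclosed d hd _ ⟨hτ d, h.trans d⟩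
      · exact fun d hd d' _ hdd' hc => hclosed d hd d' ⟨hdd'.symm, hc.symm⟩
    obtain ⟨k, hk⟩ := h1
    exact ⟨k % m, Nat.mod_lt _ hpos, by rwa [hmod] at hk⟩

/-- A colour class, cut at the vertex `none`, is a path in the graph. -/
theorem IsHamColoring.exists_path [Fintype D] {V : Type u} {G : SimpleGraph V}
    {vtx : D → Option V} {U : Finset (Option V)} (hT : IsTransition ι τ vtx U)
    (hτ : ∀ d, vtx (τ d) = vtx d)
    (hpair : ∀ d d', vtx d = vtx d' → vtx d ∉ U → d' = d ∨ d' = τ d)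
    (h : IsHamColoring ι τ vtx U c) (hU : none ∈ U) {r : D → V}
    (hadj : ∀ d, G.Adj (r d) (r (ι d))) (hr : ∀ d, vtx d ≠ none → vtx d = some (r d))
    (hend : ∀ d d', vtx d = none → r d = r d' → d = d') (b : Bool) :
    ∃ (m : ℕ) (w : ℕ → V), IsPathFn G w m ∧ (Finset.univ.filter fun d => c d = b).card ≤ 2 * m ∧
      ∀ d, c d = b → ∃ k < m, s(r d, r (ι d)) = s(w k, w (k + 1)) := by
  obtain ⟨a, _, -, ha⟩ := h.two none hU b
  obtain ⟨hanone, hab⟩ := (ha a).2 (Or.inl rfl)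
  obtain ⟨m, s, hpos, h0, hm, hvtx, hne, hinj, hcov⟩ := h.exists_trail hT hτ hpair a
  have hnone : ∀ k < m, vtx (s k) = none → k = 0 := by
    intro k hk hk'
    exact hinj k 0 hk hpos (by rw [hk', h0, hanone])
  have hstep : ∀ k, k + 1 < m → r (ι (s k)) = r (s (k + 1)) := by
    intro k hk
    have h1 : vtx (s (k + 1)) ≠ none := fun h2 => by
      have := hnone _ hk h2
      omega
    have h2 := hr _ h1
    rw [← hvtx] at h1 h2
    exact Option.some_injective _ ((hr _ h1).symm.trans h2)
  obtain ⟨w, hw0, hw1⟩ : ∃ w : ℕ → V, (∀ k < m, w k = r (s k)) ∧ ∀ k < m, w (k + 1) = r (ι (s k)) := by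
    -- The trail closes at `none`, but in `G` the path ends at the far end of its last edge, which
    -- is not `r (s m) = r (s 0)`.
    refine ⟨fun k => if k < m then r (s k) else r (ι (s (k - 1))), fun k hk => if_pos hk, ?_⟩
    intro k hk
    by_cases h1 : k + 1 < m
    · simp only [if_pos h1, hstep k h1]
    · simp only [if_neg h1, Nat.add_sub_cancel]
  have hlt : ∀ j k, j < k → k ≤ m → w j ≠ w k := by
    intro j k hjk hk heq
    rw [hw0 j (by omega)] at heq
    by_cases hkm : k < m
    · rw [hw0 k hkm] at heq
      by_cases h1 : vtx (s j) = none
      · have := hinj j k (by omega) hkm (by rw [hend _ _ h1 heq])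
        omega
      · have h2 : vtx (s k) ≠ none := fun h2 => by
          have := hnone k hkm h2
          omega
        have := hinj j k (by omega) hkm (by rw [hr _ h1, hr _ h2, heq])
        omega
    · obtain rfl : k = m := by omega
      have h1 := hw1 (k - 1) (by omega)
      have h2 := hvtx (k - 1)
      have h3 := hne (k - 1)
      rw [show k - 1 + 1 = k by omega] at h1 h2 h3
      rw [h1] at heq
      rw [hm] at h2 h3
      -- A repetition of the last vertex would force the last dart to equal `s j` with `j = 0`,
      -- against the trail using two different darts at `none`.
      have h4 := hend _ _ (h2.trans hanone) heq.symm
      have h5 := hnone j (by omega) (by rw [← h4, h2, hanone])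
      subst h5
      rw [h0] at h4
      exact h3 h4
  refine ⟨m, w, ⟨?_, ?_⟩, ?_, ?_⟩
  · intro k hk
    rw [hw0 k hk, hw1 k hk]
    exact hadj _
  · intro j k hj hk hjk
    rcases lt_trichotomy j k with h1 | h1 | h1
    · exact (hlt j k h1 hk hjk).elim
    · exact h1
    · exact (hlt k j h1 hj hjk.symm).elim
  · classical
    have hsub : (Finset.univ.filter fun d => c d = b) ⊆
        (Finset.range m).image s ∪ (Finset.range m).image (fun k => ι (s k)) := by
      intro d hd
      simp only [Finset.mem_filter, Finset.mem_univ, true_and] at hd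
      obtain ⟨k, hk, hk' | hk'⟩ := hcov d (hd.trans hab.symm)
      · exact Finset.mem_union_left _ (Finset.mem_image.2 ⟨k, Finset.mem_range.2 hk, hk'.symm⟩)
      · exact Finset.mem_union_right _ (Finset.mem_image.2 ⟨k, Finset.mem_range.2 hk, hk'.symm⟩)
    refine (Finset.card_le_card hsub).trans ((Finset.card_union_le _ _).trans ?_)
    have h1 : ((Finset.range m).image s).card ≤ m := by
      simpa using Finset.card_image_le (s := Finset.range m) (f := s)
    have h2 : ((Finset.range m).image (fun k => ι (s k))).card ≤ m := by
      simpa using Finset.card_image_le (s := Finset.range m) (f := fun k => ι (s k))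
    omega
  · intro d hd
    obtain ⟨k, hk, rfl | rfl⟩ := hcov d (hd.trans hab.symm)
    · exact ⟨k, hk, by rw [hw0 k hk, hw1 k hk]⟩
    · exact ⟨k, hk, by rw [hw0 k hk, hw1 k hk, hT.inv_edge, Sym2.eq_swap]⟩

end Abstract

end HLine

namespace HLine

open Equiv

universe u

/-! ### Two crossing paths and a mixed path -/

section TwoPaths

variable {V : Type u} {G : SimpleGraph V} {N : ℕ}

/-- The position on the closed-up path of a dart. The darts of the edge `i` are `(s, i, false)` at
position `i` and `(s, i, true)` at position `i + 1`. -/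
def dartPos [NeZero N] (d : Bool × Fin N × Bool) : Fin N :=
  if d.2.2 then d.2.1 + 1 else d.2.1

/-- The other dart of an edge. -/
def dartFlip (N : ℕ) : Perm (Bool × Fin N × Bool) :=
  Function.Involutive.toPerm (fun d => (d.1, d.2.1, !d.2.2)) (fun d => by simp)

@[simp]
theorem dartFlip_apply (d : Bool × Fin N × Bool) : dartFlip N d = (d.1, d.2.1, !d.2.2) := rfl

/-- The other dart at a position of a closed-up path. -/
def dartTurn (N : ℕ) [NeZero N] : Perm (Bool × Fin N × Bool) :=
  Function.Involutive.toPerm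
    (fun d => (d.1, if d.2.2 then d.2.1 + 1 else d.2.1 - 1, !d.2.2))
    (fun d => by rcases d with ⟨s, i, _ | _⟩ <;> simp)

/-- The vertex of a dart. -/
def dartVertex (P : Bool → ℕ → V) (d : Bool × Fin N × Bool) : V :=
  P d.1 (if d.2.2 then d.2.1 + 1 else d.2.1)

/-- The vertex of a dart, where the ends of the paths are identified to `none`. -/
def dartVertexOpt [NeZero N] (P : Bool → ℕ → V) (d : Bool × Fin N × Bool) : Option V :=
  if dartPos d = 0 then none else some (P d.1 (dartPos d))

theorem dartVertex_adj {P : Bool → ℕ → V} (hP : ∀ s, IsPathFn G (P s) N)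
    (d : Bool × Fin N × Bool) : G.Adj (dartVertex P d) (dartVertex P (dartFlip N d)) := by
  rcases d with ⟨s, i, _ | _⟩
  · exact (hP s).adj i i.isLt
  · exact ((hP s).adj i i.isLt).symm

variable [NeZero N]

@[simp]
theorem dartTurn_false (s : Bool) (i : Fin N) : dartTurn N (s, i, false) = (s, i - 1, true) := rfl

@[simp]
theorem dartTurn_true (s : Bool) (i : Fin N) : dartTurn N (s, i, true) = (s, i + 1, false) := rfl

theorem dartPos_turn (d : Bool × Fin N × Bool) : dartPos (dartTurn N d) = dartPos d := by
  rcases d with ⟨s, i, _ | _⟩ <;> simp [dartPos]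

theorem dartTurn_fst (d : Bool × Fin N × Bool) : (dartTurn N d).1 = d.1 := rfl

theorem dartTurn_ne (d : Bool × Fin N × Bool) : dartTurn N d ≠ d := by
  rcases d with ⟨s, i, _ | _⟩ <;> simp

theorem dartTurn_turn (d : Bool × Fin N × Bool) : dartTurn N (dartTurn N d) = d := by
  rcases d with ⟨s, i, _ | _⟩ <;> simp

theorem eq_or_eq_dartTurn {d e : Bool × Fin N × Bool} (h1 : e.1 = d.1)
    (h2 : dartPos e = dartPos d) : e = d ∨ e = dartTurn N d := by
  rcases d with ⟨s, i, _ | _⟩ <;> rcases e with ⟨s', i', _ | _⟩ <;>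
    simp [dartPos] at h1 h2 ⊢ <;> simp [h1, ← h2]

theorem dartVertexOpt_eq_none {P : Bool → ℕ → V} {d : Bool × Fin N × Bool} :
    dartVertexOpt P d = none ↔ dartPos d = 0 := by
  unfold dartVertexOpt
  split_ifs with h <;> simp [h]

theorem fin_val_add_one_eq {i : Fin N} (h : i + 1 = 0) : (i : ℕ) + 1 = N := by
  by_contra h1
  have h2 := Fin.val_add_one_of_lt' (show (i : ℕ) + 1 < N by omega)
  rw [h] at h2
  simp at h2

theorem fin_val_add_one {i : Fin N} (h : i + 1 ≠ 0) : ((i + 1 : Fin N) : ℕ) = i + 1 := by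
  by_cases h1 : (i : ℕ) + 1 < N
  · exact Fin.val_add_one_of_lt' h1
  · exfalso
    apply h
    ext
    rw [Fin.val_add, Fin.val_zero]
    rcases Nat.lt_or_ge 1 N with h2 | h2
    · rw [Fin.val_one', Nat.mod_eq_of_lt h2, show (i : ℕ) + 1 = N by omega, Nat.mod_self]
    · obtain rfl : N = 1 := by omega
      exact Nat.mod_one _

theorem dartVertexOpt_eq_some {P : Bool → ℕ → V} {d : Bool × Fin N × Bool}
    (h : dartVertexOpt P d ≠ none) : dartVertexOpt P d = some (dartVertex P d) := by
  rw [ne_eq, dartVertexOpt_eq_none] at h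
  rw [dartVertexOpt, if_neg h, dartVertex]
  rcases d with ⟨s, i, _ | _⟩
  · simp [dartPos]
  · simp only [dartPos, if_true] at h ⊢
    rw [fin_val_add_one h]

theorem dartVertexOpt_congr {P : Bool → ℕ → V} {d e : Bool × Fin N × Bool} (h1 : e.1 = d.1)
    (h2 : dartPos e = dartPos d) : dartVertexOpt P e = dartVertexOpt P d := by
  unfold dartVertexOpt
  rw [h1, h2]

theorem dartPos_eq_of_dartVertexOpt_eq {P : Bool → ℕ → V} (hP : ∀ s, IsPathFn G (P s) N)
    {d e : Bool × Fin N × Bool} (h1 : e.1 = d.1) (h2 : dartVertexOpt P e = dartVertexOpt P d) :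
    dartPos e = dartPos d := by
  unfold dartVertexOpt at h2
  rw [h1] at h2
  split_ifs at h2 with h3 h4 h4
  · rw [h3, h4]
  · exact Fin.ext ((hP d.1).inj _ _ (dartPos e).isLt.le (dartPos d).isLt.le
      (Option.some_injective _ h2))

/-- The ends of the two paths belong to one dart only. -/
theorem eq_of_dartVertex_eq {P : Bool → ℕ → V} (hP : ∀ s, IsPathFn G (P s) N)
    (hends : ∀ s, ∀ i ≤ N, P (!s) i ≠ P s 0 ∧ P (!s) i ≠ P s N)
    {d e : Bool × Fin N × Bool} (hd : dartVertexOpt P d = none)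
    (hde : dartVertex P d = dartVertex P e) : d = e := by
  rw [dartVertexOpt_eq_none] at hd
  rcases d with ⟨s, i, t⟩
  rcases e with ⟨s', i', t'⟩
  have hi := i.isLt
  have hi' := i'.isLt
  obtain ⟨k, hk, hk', hkd⟩ : ∃ k ≤ N, (k = 0 ∨ k = N) ∧ dartVertex P (s, i, t) = P s k := by
    cases t
    · exact ⟨i, by omega, Or.inl (by simpa [dartPos] using hd), by simp [dartVertex]⟩
    · exact ⟨i + 1, by omega, Or.inr (fin_val_add_one_eq (by simpa [dartPos] using hd)),
        by simp [dartVertex]⟩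
  obtain ⟨l, hl, hle⟩ : ∃ l ≤ N, dartVertex P (s', i', t') = P s' l := by
    cases t'
    · exact ⟨i', by omega, by simp [dartVertex]⟩
    · exact ⟨i' + 1, by omega, by simp [dartVertex]⟩
  obtain rfl : s' = s := by
    by_contra hss
    obtain rfl : s' = !s := by
      revert hss
      cases s <;> cases s' <;> simp
    have := hends s l hl
    rw [hkd, hle] at hde
    rcases hk' with rfl | rfl
    · exact this.1 hde.symm
    · exact this.2 hde.symm
  cases t <;> cases t' <;> simp only [dartVertex, dartPos, if_true, if_false, reduceCtorEq] at hd hde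
  · have := (hP s').inj _ _ (by omega) (by omega) hde
    simp [Fin.ext_iff, this]
  · have := (hP s').inj _ _ (by omega) (by omega) hde
    simp [hd] at this
  · have := (hP s').inj _ _ (by omega) (by omega) hde
    have := fin_val_add_one_eq hd
    omega
  · have := (hP s').inj _ _ (by omega) (by omega) hde
    simp [Fin.ext_iff]
    omega

/-- Alternating flips and turns runs around the whole closed-up path; this gives connectedness of
the original colour classes. -/
theorem dart_mem_of_closed (A : Set (Bool × Fin N × Bool)) (h1 : ∀ d ∈ A, dartFlip N d ∈ A)
    (h2 : ∀ d ∈ A, dartTurn N d ∈ A) (d : Bool × Fin N × Bool) (hd : d ∈ A)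
    (e : Bool × Fin N × Bool) (hde : d.1 = e.1) : e ∈ A := by
  have hflip : ∀ s i, ∀ t t' : Bool, (s, i, t) ∈ A → (s, i, t') ∈ A := by
    intro s i t t' h
    by_cases ht : t' = t
    · rwa [ht]
    · obtain rfl : t' = !t := by
        revert ht
        cases t <;> cases t' <;> simp
      exact h1 _ h
  rcases d with ⟨s, i, t⟩
  rcases e with ⟨s', j, t'⟩
  obtain rfl : s = s' := hde
  have hstep : ∀ k : ℕ, (s, i + Fin.ofNat N k, true) ∈ A := by
    intro k
    induction k with
    | zero => simpa using hflip s i t true hd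
    | succ k ih =>
      have h3 := hflip _ _ _ true (h2 _ ih)
      have h4 : Fin.ofNat N (k + 1) = Fin.ofNat N k + 1 := by
        ext
        simp [Fin.val_add]
      rw [h4, ← add_assoc]
      exact h3
  have h3 := hflip _ _ _ t' (hstep (j - i : Fin N))
  rwa [show Fin.ofNat N ((j - i : Fin N) : ℕ) = j - i by simp, add_sub_cancel] at h3

/-- The prescribed transitions of the union of two paths: at vertices outside of `U`, the two darts
at the vertex are joined. -/
theorem exists_dart_transition (P : Bool → ℕ → V) (U : Finset (Option V)) :
    ∃ τ : Perm (Bool × Fin N × Bool), IsTransition (dartFlip N) τ (dartVertexOpt P) U ∧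
      ∀ d, τ d = d ∧ dartVertexOpt P d ∈ U ∨ τ d = dartTurn N d ∧ dartVertexOpt P d ∉ U := by
  classical
  have hturn : ∀ d, dartVertexOpt P (dartTurn N d) = dartVertexOpt P d :=
    fun d => dartVertexOpt_congr (dartTurn_fst d) (dartPos_turn d)
  have hinv : Function.Involutive
      fun d : Bool × Fin N × Bool => if dartVertexOpt P d ∈ U then d else dartTurn N d := by
    intro d
    by_cases hd : dartVertexOpt P d ∈ U
    · simp [hd]
    · simp [hd, hturn, dartTurn_turn]
  have hτ : ∀ d, hinv.toPerm _ d = if dartVertexOpt P d ∈ U then d else dartTurn N d := fun d => rfl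
  refine ⟨hinv.toPerm _, ⟨fun d => by simp, ?_, hinv, ?_⟩, ?_⟩
  · rintro ⟨s, i, t⟩ h
    simp at h
  · intro d
    rw [hτ]
    split_ifs with hd <;> simp [hd, dartTurn_ne]
  · intro d
    rw [hτ]
    split_ifs with hd <;> simp [hd]

/-- Two paths with `N` edges that intersect, none of them containing an end of the other one:
there is a path with at least `N` edges that has edges of both. -/
theorem exists_mixed_path (P : Bool → ℕ → V) (hP : ∀ s, IsPathFn G (P s) N)
    (hends : ∀ s, ∀ i ≤ N, P (!s) i ≠ P s 0 ∧ P (!s) i ≠ P s N)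
    {a b : ℕ} (ha : a ≤ N) (hb : b ≤ N) (hab : P false a = P true b) :
    ∃ (m : ℕ) (w : ℕ → V), N ≤ m ∧ IsPathFn G w m ∧
      ∀ s, ∃ i < N, ∃ k < m, s(P s i, P s (i + 1)) = s(w k, w (k + 1)) := by
  classical
  set vtx : Bool × Fin N × Bool → Option V := dartVertexOpt P with hvtx
  -- The vertices of degree four: those on both closed-up paths, including the common end `none`.
  -- All others have degree two, so their transitions are forced.
  let U : Finset (Option V) := (Finset.univ.image vtx).filter fun v => ∀ s, ∃ d, d.1 = s ∧ vtx d = v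
  have memU : ∀ v, v ∈ U ↔ ∀ s, ∃ d, d.1 = s ∧ vtx d = v := by
    intro v
    simp only [U, Finset.mem_filter, Finset.mem_image, Finset.mem_univ, true_and,
      and_iff_right_iff_imp]
    intro h
    obtain ⟨d, -, hd⟩ := h true
    exact ⟨d, hd⟩
  have hnone : none ∈ U := (memU _).2 fun s => ⟨(s, 0, false), rfl, by
    rw [hvtx, dartVertexOpt_eq_none]; simp [dartPos]⟩
  have hsome : some (P false a) ∈ U := by
    have key : ∀ s k, 0 < k → ∀ hk : k < N, vtx (s, ⟨k, hk⟩, false) = some (P s k) := by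
      intro s k h0 hk
      have : (⟨k, hk⟩ : Fin N) ≠ 0 := by
        intro h
        rw [Fin.ext_iff] at h
        simp at h
        omega
      simp [hvtx, dartVertexOpt, dartPos, this]
    have hmid : ∀ s i j, i ≤ N → j ≤ N → P s i = P (!s) j → 0 < i ∧ i < N := by
      intro s i j hi hj hij
      have h1 := hends s j hj
      rw [← hij] at h1
      constructor
      · rw [Nat.pos_iff_ne_zero]
        rintro rfl
        exact h1.1 rfl
      · refine lt_of_le_of_ne hi ?_
        rintro rfl
        exact h1.2 rfl
    obtain ⟨ha0, haN⟩ := hmid false a b ha hb hab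
    obtain ⟨hb0, hbN⟩ := hmid true b a hb ha hab.symm
    refine (memU _).2 fun s => ?_
    cases s
    · exact ⟨_, rfl, key false a ha0 haN⟩
    · exact ⟨_, rfl, by rw [key true b hb0 hbN, hab]⟩
  obtain ⟨τ, hT, hτ⟩ := exists_dart_transition (N := N) P U
  have hturn : ∀ d, vtx (dartTurn N d) = vtx d :=
    fun d => dartVertexOpt_congr (dartTurn_fst d) (dartPos_turn d)
  have hτvtx : ∀ d, vtx (τ d) = vtx d := by
    intro d
    rcases hτ d with ⟨h, -⟩ | ⟨h, -⟩
    · rw [h]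
    · rw [h, hturn]
  have hpair : ∀ d d', vtx d = vtx d' → vtx d ∉ U → d' = d ∨ d' = τ d := by
    intro d d' hdd' hd
    have h1 : d'.1 = d.1 := by
      by_contra h1
      refine hd ((memU _).2 fun s => ?_)
      by_cases h2 : s = d.1
      · exact ⟨d, h2.symm, rfl⟩
      · refine ⟨d', ?_, hdd'.symm⟩
        exact (show ∀ p q r : Bool, p ≠ q → r ≠ q → p = r by decide) _ _ _ h1 h2
    rcases hτ d with ⟨-, h⟩ | ⟨h, -⟩
    · exact (hd h).elim
    · rw [h]
      exact eq_or_eq_dartTurn h1 (dartPos_eq_of_dartVertexOpt_eq hP h1 hdd'.symm)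
  have hham : IsHamColoring (dartFlip N) τ vtx U (fun d => d.1) := by
    refine ⟨fun d => rfl, ?_, ?_, ?_⟩
    · intro d
      rcases hτ d with ⟨h, -⟩ | ⟨h, -⟩
      · rw [h]
      · rw [h, dartTurn_fst]
    · intro v hv s
      obtain ⟨d, rfl, rfl⟩ := (memU v).1 hv s
      refine ⟨d, dartTurn N d, (dartTurn_ne d).symm, fun e => ⟨?_, ?_⟩⟩
      · rintro ⟨h1, h2⟩
        exact eq_or_eq_dartTurn h2 (dartPos_eq_of_dartVertexOpt_eq hP h2 h1)
      · rintro (rfl | rfl)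
        · exact ⟨rfl, rfl⟩
        · exact ⟨hturn d, dartTurn_fst d⟩
    · intro A h1 h2 h3
      refine dart_mem_of_closed A h1 ?_
      intro d hd
      rcases hτ d with ⟨-, h⟩ | ⟨h, -⟩
      · exact h3 d hd _ h (hturn d).symm (dartTurn_fst d).symm
      · rw [← h]
        exact h2 d hd
  have hU : 2 ≤ U.card := Finset.one_lt_card.2 ⟨none, hnone, _, hsome, by simp⟩
  obtain ⟨c, hc, hne, hx, hy⟩ := hham.exists_other hT hU (x := (false, 0, false))
    (y := (true, 0, false)) rfl rfl
  -- A new class with edges of one path only would be contained in an old class, hence equal to it,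
  -- and the colourings would agree.
  have hmix : ∀ b s, ∃ d, c d = b ∧ d.1 = s := by
    have hdiag : ∀ b, ∃ d, c d = b ∧ d.1 = b := by
      intro b
      cases b
      · exact ⟨_, hx, rfl⟩
      · exact ⟨_, hy, rfl⟩
    intro b s
    by_contra! h
    obtain ⟨d, hd, hdb⟩ := hdiag b
    refine hne (hham.class_eq_of_subset hc (b := b) ?_ hd)
    intro e he
    exact (show ∀ p q r : Bool, p ≠ q → r ≠ q → p = r by decide) _ _ _ (h e he)
      (by rw [← hdb]; exact h d hd)
  have hcard : (Finset.univ.filter fun d => c d = true).card +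
      (Finset.univ.filter fun d => c d = false).card = 4 * N := by
    have := Finset.card_filter_add_card_filter_not (s := (Finset.univ : Finset (Bool × Fin N × Bool)))
      (fun d => c d = true)
    simp only [Bool.not_eq_true, Finset.card_univ, Fintype.card_prod, Fintype.card_bool,
      Fintype.card_fin] at this
    omega
  -- One of the two classes has at least half of the `4 * N` darts, that is, at least `N` edges.
  obtain ⟨b, hb⟩ : ∃ b, 2 * N ≤ (Finset.univ.filter fun d => c d = b).card := by
    by_contra! h
    have h1 := h true
    have h2 := h false
    omega
  obtain ⟨m, w, hw, hm, hedge⟩ := hc.exists_path hT hτvtx hpair hnone (dartVertex_adj hP)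
    (fun d hd => dartVertexOpt_eq_some hd) (fun d e hd => eq_of_dartVertex_eq hP hends hd) b
  refine ⟨m, w, by omega, hw, fun s => ?_⟩
  obtain ⟨⟨s', i, t⟩, hd, rfl⟩ := hmix b s
  obtain ⟨k, hk, hk'⟩ := hedge _ hd
  refine ⟨i, i.isLt, k, hk, ?_⟩
  rw [← hk']
  cases t
  · simp [dartVertex]
  · simp [dartVertex, Sym2.eq_swap]

end TwoPaths

end HLine

/-! ### Paths on `n` vertices span one component of the line graph -/

namespace HLine

open SimpleGraph

universe u

variable {V : Type u} {G : SimpleGraph V} {n N : ℕ} {p q : ℕ → V}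

/-- `e` and `f` are edges of `G` in the same component of the `P_n`-line graph of `G`. -/
def EdgeReachable (n : ℕ) (G : SimpleGraph V) (e f : Sym2 V) : Prop :=
  ∃ (he : e ∈ G.edgeSet) (hf : f ∈ G.edgeSet),
    (hLineGraph (pathGraph n) G).Reachable ⟨e, he⟩ ⟨f, hf⟩

namespace EdgeReachable

variable {e f g : Sym2 V}

theorem refl (he : e ∈ G.edgeSet) : EdgeReachable n G e e := ⟨he, he, Reachable.refl _⟩

theorem symm (h : EdgeReachable n G e f) : EdgeReachable n G f e := by
  obtain ⟨he, hf, h⟩ := h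
  exact ⟨hf, he, h.symm⟩

theorem trans (h : EdgeReachable n G e f) (h' : EdgeReachable n G f g) : EdgeReachable n G e g := by
  obtain ⟨he, hf, h⟩ := h
  obtain ⟨_, hg, h'⟩ := h'
  exact ⟨he, hg, h.trans h'⟩

end EdgeReachable

theorem EdgeAdj.edgeReachable {e f : Sym2 V} (h : EdgeAdj n G e f) : EdgeReachable n G e f := by
  obtain ⟨he, hf, h⟩ := h
  exact ⟨he, hf, h.reachable⟩

theorem IsPathFn.edgeReachable_zero {k : ℕ} (hp : IsPathFn G p k) (hn : 3 ≤ n) (hk : n ≤ k + 1)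
    {i : ℕ} (hi : i < k) : EdgeReachable n G s(p 0, p 1) s(p i, p (i + 1)) := by
  induction i with
  | zero => exact .refl (hp.adj 0 hi)
  | succ i ih => exact (ih (by omega)).trans (hp.edgeAdj hn hk (by omega)).edgeReachable

theorem IsPathFn.edgeReachable {k : ℕ} (hp : IsPathFn G p k) (hn : 3 ≤ n) (hk : n ≤ k + 1)
    {i j : ℕ} (hi : i < k) (hj : j < k) :
    EdgeReachable n G s(p i, p (i + 1)) s(p j, p (j + 1)) :=
  (hp.edgeReachable_zero hn hk hi).symm.trans (hp.edgeReachable_zero hn hk hj)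

/-- A path with edges of both `p` and `q` connects them in the line graph. -/
theorem edgeReachable_of_mixed (hn : 3 ≤ n) (hN : n ≤ N + 1) (hp : IsPathFn G p N)
    (hq : IsPathFn G q N) {m : ℕ} {w : ℕ → V} (hw : IsPathFn G w m) (hm : N ≤ m)
    (h1 : ∃ i < N, ∃ k < m, s(p i, p (i + 1)) = s(w k, w (k + 1)))
    (h2 : ∃ i < N, ∃ k < m, s(q i, q (i + 1)) = s(w k, w (k + 1))) :
    EdgeReachable n G s(p 0, p 1) s(q 0, q 1) := by
  obtain ⟨i, hi, k, hk, h1⟩ := h1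
  obtain ⟨j, hj, l, hl, h2⟩ := h2
  refine (hp.edgeReachable_zero hn hN hi).trans (.trans ?_ (hq.edgeReachable_zero hn hN hj).symm)
  rw [h1, h2]
  exact hw.edgeReachable hn (by omega) hk hl

/-- An edge of `q` at `p 0` is either the first edge of `p` or an extra edge at the start of `p`,
hence adjacent to that first edge. -/
theorem edgeReachable_of_start (hn : 3 ≤ n) (hN : n ≤ N + 1) (hp : IsPathFn G p N)
    (hq : IsPathFn G q N) {j : ℕ} (hj : j ≤ N) (h : p 0 = q j) :
    EdgeReachable n G s(p 0, p 1) s(q 0, q 1) := by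
  have key : ∀ i < N, ∀ w, s(q i, q (i + 1)) = s(p 0, w) →
      EdgeReachable n G s(p 0, p 1) s(q 0, q 1) := by
    intro i hi w hw
    refine EdgeReachable.trans ?_ (hq.edgeReachable_zero hn hN hi).symm
    have hadj : s(p 0, w) ∈ G.edgeSet := hw ▸ hq.adj i hi
    rw [hw]
    by_cases hw1 : w = p 1
    · rw [hw1]
      exact .refl (hp.adj 0 (by omega))
    · exact (hp.edgeAdj_extra hn hN hadj hw1).edgeReachable
  by_cases hjN : j < N
  · exact key j hjN _ (by rw [h])
  -- No edge of `q` leaves its last vertex forwards, so the preceding edge is used.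
  · refine key (j - 1) (by omega) (q (j - 1)) ?_
    rw [show j - 1 + 1 = j by omega, h, Sym2.eq_swap]

theorem edgeReachable_of_end (hn : 3 ≤ n) (hN : n ≤ N + 1) (hp : IsPathFn G p N)
    (hq : IsPathFn G q N) {j : ℕ} (hj : j ≤ N) (h : p 0 = q j ∨ p N = q j) :
    EdgeReachable n G s(p 0, p 1) s(q 0, q 1) := by
  rcases h with h | h
  · exact edgeReachable_of_start hn hN hp hq hj h
  · have h1 := edgeReachable_of_start hn hN hp.reverse hq hj (by simpa using h)
    refine EdgeReachable.trans ?_ h1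
    have h2 := hp.edgeReachable_zero hn hN (i := N - 1) (by omega)
    rw [show N - 1 + 1 = N by omega, Sym2.eq_swap (a := p (N - 1))] at h2
    simpa using h2

/-- The longer part of a path that ends in a given vertex. -/
theorem IsPathFn.exists_half (hp : IsPathFn G p N) {a : ℕ} (ha : a ≤ N) (hN : 0 < N) :
    ∃ (k : ℕ) (h : ℕ → V), 0 < k ∧ N ≤ 2 * k ∧ IsPathFn G h k ∧ h k = p a ∧
      (∀ i ≤ k, ∃ j ≤ N, h i = p j) ∧ ∃ j < N, s(p j, p (j + 1)) = s(h 0, h 1) := by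
  by_cases h : N ≤ 2 * a
  · exact ⟨a, p, by omega, h, hp.mono ha, rfl, fun i hi => ⟨i, by omega, rfl⟩, 0, hN, rfl⟩
  · refine ⟨N - a, fun i => p (N - i), by omega, by omega, hp.reverse.mono (by omega), ?_,
      fun i hi => ⟨N - i, by omega, rfl⟩, N - 1, by omega, ?_⟩
    · simp only [show N - (N - a) = a by omega]
    · rw [show N - 1 + 1 = N by omega, Sym2.eq_swap]
      simp

/-- A shortest path between two paths. -/
theorem exists_connecting_path (h : G.Reachable (p 0) (q 0)) :
    ∃ (l : ℕ) (z : ℕ → V), IsPathFn G z l ∧ (∃ a ≤ N, z 0 = p a) ∧ (∃ b ≤ N, z l = q b) ∧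
      (∀ i ≤ l, (∃ a ≤ N, z i = p a) → i = 0) ∧ ∀ i ≤ l, (∃ b ≤ N, z i = q b) → i = l := by
  classical
  have hex : ∃ l, ∃ z : ℕ → V, IsPathFn G z l ∧ (∃ a ≤ N, z 0 = p a) ∧ ∃ b ≤ N, z l = q b := by
    obtain ⟨w⟩ := h
    have hw := w.toPath.2
    refine ⟨w.toPath.1.length, w.toPath.1.getVert, ⟨?_, ?_⟩, ⟨0, by omega, by simp⟩,
      ⟨0, by omega, by simp⟩⟩
    · intro i hi
      exact w.toPath.1.adj_getVert_succ hi
    · intro i j hi hj hij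
      exact hw.getVert_injOn hi hj hij
  obtain ⟨z, hz, ha, hb⟩ := Nat.find_spec hex
  refine ⟨Nat.find hex, z, hz, ha, hb, ?_, ?_⟩
  · intro i hi hia
    by_contra h0
    refine Nat.find_min hex (m := Nat.find hex - i) (by omega) ⟨_, hz.drop hi, hia, ?_⟩
    simpa only [show i + (Nat.find hex - i) = Nat.find hex by omega] using hb
  · intro i hi hib
    by_contra h0
    exact Nat.find_min hex (m := i) (by omega) ⟨_, hz.mono hi, ha, hib⟩

/-- The longer half of `p`, a shortest connection and the longer half of `q` form a path. The halves
have at least `N / 2` edges each, so it is long enough, and it contains an end edge of either path.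
-/
theorem edgeReachable_of_disjoint (hn : 3 ≤ n) (hN : n ≤ N + 1) (hp : IsPathFn G p N)
    (hq : IsPathFn G q N) (hdisj : ∀ i j, i ≤ N → j ≤ N → p i ≠ q j)
    (h : G.Reachable (p 0) (q 0)) : EdgeReachable n G s(p 0, p 1) s(q 0, q 1) := by
  obtain ⟨l, z, hz, ⟨a, ha, hza⟩, ⟨b, hb, hzb⟩, hzp, hzq⟩ := exists_connecting_path (N := N) h
  obtain ⟨k, f, hk0, hk, hf, hfa, hfp, i, hi, hif⟩ := hp.exists_half ha (by omega)
  obtain ⟨k', g, hk0', hk', hg, hgb, hgq, j, hj, hjg⟩ := hq.exists_half hb (by omega)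
  have hl : 0 < l := by
    rw [Nat.pos_iff_ne_zero]
    rintro rfl
    exact hdisj a b ha hb (by rw [← hza, ← hzb])
  have h1 := hf.append hz (by rw [hfa, hza]) (by
    intro x y hx hy hxy
    obtain ⟨c, hc, hc'⟩ := hfp x hx
    exact hzp y hy ⟨c, hc, by rw [← hxy, hc']⟩)
  have h2 := h1.append hg.reverse (by
    simp only [show ¬ k + l ≤ k by omega, if_false, Nat.add_sub_cancel_left, Nat.sub_zero, hgb, hzb])
    (by
      intro x y hx hy hxy
      obtain ⟨d, hd, hd'⟩ := hgq (k' - y) (by omega)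
      by_cases hxk : x ≤ k
      · obtain ⟨c, hc, hc'⟩ := hfp x hxk
        simp only [hxk, if_true] at hxy
        exact (hdisj c d hc hd (by rw [← hc', hxy, hd'])).elim
      · simp only [hxk, if_false] at hxy
        have h3 := hzq (x - k) (by omega) ⟨d, hd, by rw [hxy, hd']⟩
        rw [h3, hzb, ← hgb] at hxy
        have := hg.inj _ _ le_rfl (by omega) hxy
        omega)
  refine edgeReachable_of_mixed hn hN hp hq h2 (by omega) ⟨i, hi, 0, by omega, ?_⟩
    ⟨j, hj, k + l + k' - 1, by omega, ?_⟩
  · rw [hif]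
    simp [show 1 ≤ k + l by omega, show 1 ≤ k by omega]
  · rw [hjg, Sym2.eq_swap]
    have e1 : k + l + k' - 1 + 1 = k + l + k' := by omega
    have e2 : ¬ k + l + k' ≤ k + l := by omega
    have e3 : k' - (k + l + k' - (k + l)) = 0 := by omega
    rw [e1]
    simp only [e2, if_false, e3]
    by_cases h3 : k' = 1
    · subst h3
      simp only [Nat.add_sub_cancel, le_rfl, if_true, show ¬ k + l ≤ k by omega, if_false,
        Nat.add_sub_cancel_left, hzb, ← hgb]
    · have e4 : ¬ k + l + k' - 1 ≤ k + l := by omega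
      have e5 : k' - (k + l + k' - 1 - (k + l)) = 1 := by omega
      simp only [e4, if_false, e5]

/-- The edges of all paths on `n` vertices in one component of `G` lie in one component of the
`P_n`-line graph. -/
theorem edgeReachable_of_paths (hn : 3 ≤ n) (hN : n ≤ N + 1) (hp : IsPathFn G p N)
    (hq : IsPathFn G q N) (h : G.Reachable (p 0) (q 0)) :
    EdgeReachable n G s(p 0, p 1) s(q 0, q 1) := by
  by_cases hdisj : ∀ i j, i ≤ N → j ≤ N → p i ≠ q j
  · exact edgeReachable_of_disjoint hn hN hp hq hdisj h
  push Not at hdisj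
  obtain ⟨a, b, ha, hb, hab⟩ := hdisj
  by_cases h1 : ∃ j ≤ N, p 0 = q j ∨ p N = q j
  · obtain ⟨j, hj, h1⟩ := h1
    exact edgeReachable_of_end hn hN hp hq hj h1
  by_cases h2 : ∃ j ≤ N, q 0 = p j ∨ q N = p j
  · obtain ⟨j, hj, h2⟩ := h2
    exact (edgeReachable_of_end hn hN hq hp hj h2).symm
  push Not at h1 h2
  have : NeZero N := ⟨by omega⟩
  obtain ⟨m, w, hm, hw, hmix⟩ := exists_mixed_path (G := G) (N := N)
    (fun s => if s then q else p) (by intro s; cases s <;> simpa) (by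
      intro s i hi
      cases s
      · simpa using ⟨(h1 i hi).1.symm, (h1 i hi).2.symm⟩
      · simpa using ⟨(h2 i hi).1.symm, (h2 i hi).2.symm⟩) ha hb (by simpa using hab)
  exact edgeReachable_of_mixed hn hN hp hq hw hm (by simpa using hmix false)
    (by simpa using hmix true)

end HLine

/-! ### Two lollipops under iteration -/

namespace HLine

open SimpleGraph

universe u

variable {V : Type u} {G : SimpleGraph V} {n N : ℕ}

/-- Two lollipops on `n` vertices in the same component, the second one with an edge outside of the
first one. The first one has a tail on `j` vertices. -/
def HasTwoLollipops (G : SimpleGraph V) (n j : ℕ) : Prop :=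
  ∃ (f g : ℕ → V) (l : ℕ), IsLollipop G n f j ∧ IsLollipop G n g l ∧ G.Reachable (f 0) (g 0) ∧
    ∃ i < n, ∀ k < n, lollipopEdge n g l i ≠ lollipopEdge n f j k

theorem mem_lollipopEdge {f : ℕ → V} {j i : ℕ} (hi : i < n) : f i ∈ lollipopEdge n f j i := by
  unfold lollipopEdge
  split_ifs with h
  · simp
  · rw [show i = n - 1 by omega]
    simp

theorem exists_of_mem_lollipopEdge {f : ℕ → V} {j i : ℕ} (hj : j < n) {v : V}
    (hv : v ∈ lollipopEdge n f j i) : ∃ k < n, f k = v := by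
  unfold lollipopEdge at hv
  split_ifs at hv with h <;> rw [Sym2.mem_iff] at hv <;> rcases hv with rfl | rfl
  · exact ⟨_, by omega, rfl⟩
  · exact ⟨_, h, rfl⟩
  · exact ⟨_, by omega, rfl⟩
  · exact ⟨_, hj, rfl⟩

/-- Edge `i` of the second lollipop is a new vertex outside the first one. The new edge `i` contains
this vertex, so the same index witnesses the difference again. -/
theorem HasTwoLollipops.succ {j : ℕ} (hn : 3 ≤ n) (h : HasTwoLollipops G n j) :
    HasTwoLollipops (hLineGraph (pathGraph n) G) n (j - 1) := by
  obtain ⟨f, g, l, hf, hg, hr, i, hi, hne⟩ := h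
  have hle := hf.le
  refine ⟨_, _, _, hf.edges hn le_rfl, hg.edges hn le_rfl, ?_, i, hi, ?_⟩
  · obtain ⟨_, _, h1⟩ := edgeReachable_of_paths hn (by omega) hf.path hg.path hr
    have h2 : ∀ (f : ℕ → V) j, lollipopEdge n f j 0 = s(f 0, f 1) :=
      fun f j => lollipopEdge_of_lt (by omega)
    simpa only [h2] using h1
  · intro k hk heq
    have h1 := mem_lollipopEdge (n := n) (j := l - 1)
      (f := fun i => (⟨lollipopEdge n g l i, hg.lollipopEdge_mem i⟩ : G.edgeSet)) hi
    rw [heq] at h1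
    obtain ⟨k', hk', h2⟩ := exists_of_mem_lollipopEdge (by omega) h1
    exact hne k' hk' (congrArg Subtype.val h2).symm

theorem lollipopEdge_cycle {f : ℕ → V} {a : ℕ} (ha : a < n) :
    lollipopEdge n f 0 a = s(f a, f ((a + 1) % n)) := by
  by_cases h1 : a + 1 < n
  · rw [lollipopEdge_of_lt h1, Nat.mod_eq_of_lt h1]
  · obtain rfl : a = n - 1 := by omega
    rw [lollipopEdge_last, show n - 1 + 1 = n by omega, Nat.mod_self]

namespace IsLollipop

variable {f : ℕ → V}

theorem rotate (h : IsLollipop G n f 0) (a : ℕ) : IsLollipop G n (fun i => f ((a + i) % n)) 0 := by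
  have hle := h.le
  have hadj : ∀ i, G.Adj (f (i % n)) (f ((i + 1) % n)) := by
    intro i
    have h1 := h.lollipopEdge_mem (i % n)
    rw [lollipopEdge_cycle (Nat.mod_lt _ (by omega)), Nat.mod_add_mod] at h1
    exact h1
  refine ⟨⟨fun i hi => hadj (a + i), ?_⟩, ?_, h.le⟩
  · intro i j hi hj hij
    have h1 := h.path.inj _ _ (Nat.le_sub_one_of_lt (Nat.mod_lt _ (by omega)))
      (Nat.le_sub_one_of_lt (Nat.mod_lt _ (by omega))) hij
    have h2 : i ≡ j [MOD n] := Nat.ModEq.add_left_cancel' a h1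
    rwa [Nat.ModEq, Nat.mod_eq_of_lt (by omega), Nat.mod_eq_of_lt (by omega)] at h2
  · have h1 := hadj (a + (n - 1))
    rwa [show a + (n - 1) + 1 = a + n by omega, Nat.add_mod_right] at h1

theorem hasTouchedCycle (h : IsLollipop G n f 0) {a : ℕ} (ha : a < n) {w : V}
    (hw : G.Adj (f a) w) (hne : ∀ k < n, lollipopEdge n f 0 k ≠ s(f a, w)) :
    HasTouchedCycle G n := by
  have hle := h.le
  refine ⟨_, w, h.rotate a, by simpa [Nat.mod_eq_of_lt ha] using hw, ?_, ?_⟩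
  · rintro rfl
    exact hne a ha (lollipopEdge_cycle ha)
  · rintro rfl
    have hlt : (a + (n - 1)) % n < n := Nat.mod_lt _ (by omega)
    refine hne _ hlt ?_
    rw [lollipopEdge_cycle hlt, Nat.mod_add_mod, show a + (n - 1) + 1 = a + n by omega,
      Nat.add_mod_right, Nat.mod_eq_of_lt ha, Sym2.eq_swap]

end IsLollipop

/-- An untouched cycle is an entire component, which then contains every edge of the second
lollipop. -/
theorem HasTwoLollipops.hasTouchedCycle (h : HasTwoLollipops G n 0) : HasTouchedCycle G n := by
  obtain ⟨f, g, l, hf, hg, hr, i, hi, hne⟩ := h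
  have hle := hf.le
  have hle' := hg.le
  by_contra hcon
  have hclosed : ∀ a < n, ∀ w, G.Adj (f a) w → ∃ k < n, lollipopEdge n f 0 k = s(f a, w) := by
    intro a ha w hw
    by_contra! h1
    exact hcon (hf.hasTouchedCycle ha hw h1)
  have hstep : ∀ u v, G.Adj u v → (∃ k < n, f k = u) → ∃ k < n, f k = v := by
    rintro u v huv ⟨a, ha, rfl⟩
    obtain ⟨k, hk, h1⟩ := hclosed a ha v huv
    refine exists_of_mem_lollipopEdge (n := n) (j := 0) (i := k) (by omega) ?_
    rw [h1]
    simp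
  have hreach : ∀ u v, G.Reachable u v → (∃ k < n, f k = u) → ∃ k < n, f k = v := by
    rintro u v ⟨w⟩
    induction w with
    | nil => exact id
    | cons h1 _ ih => exact fun h2 => ih (hstep _ _ h1 h2)
  have hgf : ∀ i < n, ∃ k < n, f k = g i := by
    intro i hi
    induction i with
    | zero => exact hreach _ _ hr ⟨0, by omega, rfl⟩
    | succ i ih => exact hstep _ _ (hg.path.adj i (by omega)) (ih (by omega))
  obtain ⟨a, ha, hai⟩ := hgf i hi
  obtain ⟨w, hw⟩ := Sym2.mem_iff_exists.1 (mem_lollipopEdge (f := g) (j := l) hi)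
  have h1 := hg.lollipopEdge_mem i
  rw [hw, ← hai] at h1
  obtain ⟨k, hk, h2⟩ := hclosed a ha w h1
  exact hne k hk (by rw [hw, h2, hai])

theorem HasTwoLollipops.exists_hasTouchedCycle {j : ℕ} (hn : 3 ≤ n) (h : HasTwoLollipops G n j) :
    HasTouchedCycle (hLineIter (pathGraph n) G j).graph n := by
  have key : ∀ k ≤ j, HasTwoLollipops (hLineIter (pathGraph n) G k).graph n (j - k) := by
    intro k hk
    induction k with
    | zero => exact h
    | succ k ih => exact (ih (by omega)).succ hn
  have := key j le_rfl
  rw [Nat.sub_self] at this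
  exact this.hasTouchedCycle

end HLine

/-! ### Graphs in `δ_n` as lollipops -/

namespace HLine

open SimpleGraph

universe u

variable {V : Type u} {G : SimpleGraph V}

theorem lollipopEdge_map {V' : Type*} (φ : V → V') (n : ℕ) (f : ℕ → V) (j i : ℕ) :
    lollipopEdge n (fun i => φ (f i)) j i = (lollipopEdge n f j i).map φ := by
  unfold lollipopEdge
  split_ifs <;> rfl

theorem cycleGraph_adj_iff {m : ℕ} (hm : 3 ≤ m) {i j : Fin m} : (cycleGraph m).Adj i j ↔
    (i : ℕ) + 1 = j ∨ (j : ℕ) + 1 = i ∨ ((i : ℕ) + 1 = m ∧ (j : ℕ) = 0) ∨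
      ((j : ℕ) + 1 = m ∧ (i : ℕ) = 0) := by
  have key : ∀ i j : Fin m, ((i - j : Fin m) : ℕ) = 1 ↔
      (j : ℕ) + 1 = i ∨ ((j : ℕ) + 1 = m ∧ (i : ℕ) = 0) := by
    intro i j
    have hi := i.isLt
    have hj := j.isLt
    rw [Fin.val_sub]
    rcases Nat.lt_or_ge (m - j + i) m with h | h
    · rw [Nat.mod_eq_of_lt h]
      omega
    · rw [Nat.mod_eq_sub_mod h, Nat.mod_eq_of_lt (by omega)]
      omega
  rw [cycleGraph_adj', key, key]
  omega

section Tail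

/-- The vertices of `cycleWithTail m r`, enumerated from the end of the tail. -/
def tailVertex (m r : ℕ) [NeZero m] (i : ℕ) : Fin m ⊕ Fin r :=
  if h : i < r then .inr ⟨r - 1 - i, by omega⟩ else .inl (Fin.ofNat m (i - r))

variable {m r : ℕ} [NeZero m]

theorem tailVertex_of_lt {i : ℕ} (h : i < r) :
    tailVertex m r i = .inr ⟨r - 1 - i, by omega⟩ := dif_pos h

theorem tailVertex_of_ge {i : ℕ} (h : r ≤ i) (hi : i < r + m) :
    tailVertex m r i = .inl ⟨i - r, by omega⟩ := by
  rw [tailVertex, dif_neg (by omega)]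
  congr 1
  ext
  exact Nat.mod_eq_of_lt (by omega)

theorem tailVertex_surjective (x : Fin m ⊕ Fin r) : ∃ i < r + m, tailVertex m r i = x := by
  rcases x with i | i
  · refine ⟨r + i, by omega, ?_⟩
    rw [tailVertex_of_ge (by omega) (by omega)]
    simp
  · refine ⟨r - 1 - i, by omega, ?_⟩
    rw [tailVertex_of_lt (by omega)]
    congr 1
    ext
    simp
    omega

/-- Counting from the free end of the tail gives the attaching vertex index `r`, and the last cycle
vertex closes up to it. -/
theorem isLollipop_cycleWithTail (hm : 3 ≤ m) :
    IsLollipop (cycleWithTail m r) (r + m) (tailVertex m r) r := by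
  refine ⟨⟨?_, ?_⟩, ?_, by omega⟩
  · intro i hi
    rcases lt_trichotomy (i + 1) r with h | h | h
    · rw [tailVertex_of_lt (by omega), tailVertex_of_lt h]
      refine pathGraph_adj.2 (Or.inr ?_)
      simp only
      omega
    · rw [tailVertex_of_lt (by omega), tailVertex_of_ge (by omega) (by omega)]
      refine ⟨?_, ?_⟩ <;> simp only <;> omega
    · rw [tailVertex_of_ge (by omega) (by omega), tailVertex_of_ge (by omega) (by omega)]
      refine (cycleGraph_adj_iff hm).2 (Or.inl ?_)
      simp only
      omega
  · intro i j hi hj hij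
    rcases Nat.lt_or_ge i r with h1 | h1 <;> rcases Nat.lt_or_ge j r with h2 | h2
    · rw [tailVertex_of_lt h1, tailVertex_of_lt h2, Sum.inr.injEq, Fin.mk.injEq] at hij
      omega
    · rw [tailVertex_of_lt h1, tailVertex_of_ge h2 (by omega)] at hij
      cases hij
    · rw [tailVertex_of_lt h2, tailVertex_of_ge h1 (by omega)] at hij
      cases hij
    · rw [tailVertex_of_ge h1 (by omega), tailVertex_of_ge h2 (by omega), Sum.inl.injEq,
        Fin.mk.injEq] at hij
      omega
  · rw [tailVertex_of_ge (by omega) (by omega), tailVertex_of_ge (by omega) (by omega)]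
    refine (cycleGraph_adj_iff hm).2 (Or.inr (Or.inr (Or.inl ?_)))
    simp only
    omega

theorem exists_lollipopEdge_cycleWithTail (hm : 3 ≤ m) {x y : Fin m ⊕ Fin r}
    (h : (cycleWithTail m r).Adj x y) :
    ∃ i < r + m, lollipopEdge (r + m) (tailVertex m r) r i = s(x, y) := by
  -- the edges between consecutive vertices, and the last one
  have next : ∀ {i x y}, i + 1 < r + m → tailVertex m r i = x → tailVertex m r (i + 1) = y →
      ∃ i < r + m, lollipopEdge (r + m) (tailVertex m r) r i = s(x, y) := by
    rintro i x y hi rfl rfl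
    exact ⟨i, by omega, lollipopEdge_of_lt hi⟩
  have last : ∀ {x y}, tailVertex m r (r + m - 1) = x → tailVertex m r r = y →
      ∃ i < r + m, lollipopEdge (r + m) (tailVertex m r) r i = s(x, y) := by
    rintro x y rfl rfl
    exact ⟨_, by omega, lollipopEdge_last⟩
  have eqr : ∀ (i : ℕ) (k : Fin r), i + k + 1 = r → tailVertex m r i = .inr k := by
    intro i k hk
    rw [tailVertex_of_lt (by omega)]
    congr 1
    ext
    simp only
    omega
  have eql : ∀ (i : ℕ) (k : Fin m), i = r + k → tailVertex m r i = .inl k := by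
    intro i k hk
    rw [tailVertex_of_ge (by omega) (by omega)]
    congr 1
    ext
    simp only
    omega
  rcases x with a | a <;> rcases y with b | b
  · rcases (cycleGraph_adj_iff hm).1 h with h | h | ⟨h, h'⟩ | ⟨h, h'⟩
    · exact next (i := r + a) (by omega) (eql _ _ rfl) (eql _ _ (by omega))
    · rw [Sym2.eq_swap]
      exact next (i := r + b) (by omega) (eql _ _ rfl) (eql _ _ (by omega))
    · exact last (eql _ _ (by omega)) (eql _ _ (by omega))
    · rw [Sym2.eq_swap]
      exact last (eql _ _ (by omega)) (eql _ _ (by omega))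
  · obtain ⟨h1, h2⟩ : a.val = 0 ∧ b.val = 0 := h
    rw [Sym2.eq_swap]
    exact next (i := r - 1) (by omega) (eqr _ _ (by omega)) (eql _ _ (by omega))
  · obtain ⟨h1, h2⟩ : a.val = 0 ∧ b.val = 0 := h
    exact next (i := r - 1) (by omega) (eqr _ _ (by omega)) (eql _ _ (by omega))
  · rcases pathGraph_adj.1 h with h | h
    · rw [Sym2.eq_swap]
      exact next (i := r - 1 - b) (by omega) (eqr _ _ (by omega)) (eqr _ _ (by omega))
    · exact next (i := r - 1 - a) (by omega) (eqr _ _ (by omega)) (eqr _ _ (by omega))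

end Tail

theorem MemDelta.exists_isLollipop {n : ℕ} {H : G.Subgraph} (h : MemDelta n H.coe) :
    ∃ f j, IsLollipop G n f j ∧ (∀ v, v ∈ H.verts ↔ ∃ i < n, f i = v) ∧
      ∀ e, e ∈ H.edgeSet ↔ ∃ i < n, lollipopEdge n f j i = e := by
  obtain ⟨m, r, hm, rfl, ⟨φ⟩⟩ := h
  have : NeZero m := ⟨by omega⟩
  have hL := isLollipop_cycleWithTail (m := m) (r := r) hm
  let ψ : Fin m ⊕ Fin r → V := fun x => (φ.symm x : V)
  have hψ : Function.Injective ψ := Subtype.val_injective.comp φ.symm.injective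
  have hadj : ∀ {x y}, (cycleWithTail m r).Adj x y → H.Adj (ψ x) (ψ y) := by
    intro x y hxy
    exact φ.symm.map_adj_iff.2 hxy
  refine ⟨fun i => ψ (tailVertex m r i), r, ⟨⟨?_, ?_⟩, ?_, hL.le⟩, ?_, ?_⟩
  · exact fun i hi => (hadj (hL.path.adj i hi)).adj_sub
  · exact fun i j hi hj hij => hL.path.inj i j hi hj (hψ hij)
  · exact (hadj hL.close).adj_sub
  · intro v
    constructor
    · intro hv
      obtain ⟨i, hi, h1⟩ := tailVertex_surjective (φ ⟨v, hv⟩)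
      exact ⟨i, hi, by simp [ψ, h1]⟩
    · rintro ⟨i, hi, rfl⟩
      exact (φ.symm (tailVertex m r i)).2
  · intro e
    simp only [lollipopEdge_map ψ]
    constructor
    · induction e with
      | _ u v =>
      intro he
      rw [Subgraph.mem_edgeSet] at he
      have h1 : (cycleWithTail m r).Adj (φ ⟨u, he.fst_mem⟩) (φ ⟨v, he.snd_mem⟩) :=
        φ.map_adj_iff.2 he
      obtain ⟨i, hi, h2⟩ := exists_lollipopEdge_cycleWithTail hm h1
      exact ⟨i, hi, by simp [h2, ψ]⟩
    · rintro ⟨i, hi, rfl⟩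
      have h1 := hL.lollipopEdge_mem i
      revert h1
      induction lollipopEdge (r + m) (tailVertex m r) r i with
      | _ u v => exact fun h1 => hadj h1

/-- Both subgraphs have exactly `n` edges, so an inclusion of edge sets is an equality; the vertices
follow because each one lies on an edge. Hence different subgraphs give an edge of the second
outside the first. -/
theorem subgraph_eq_of_lollipops {n j l : ℕ} {f g : ℕ → V} {H K : G.Subgraph}
    (hf : IsLollipop G n f j) (hg : IsLollipop G n g l)
    (hfv : ∀ v, v ∈ H.verts ↔ ∃ i < n, f i = v) (hgv : ∀ v, v ∈ K.verts ↔ ∃ i < n, g i = v)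
    (hfe : ∀ e, e ∈ H.edgeSet ↔ ∃ i < n, lollipopEdge n f j i = e)
    (hge : ∀ e, e ∈ K.edgeSet ↔ ∃ i < n, lollipopEdge n g l i = e)
    (h : ∀ i < n, ∃ k < n, lollipopEdge n g l i = lollipopEdge n f j k) : H = K := by
  classical
  have hcard : ∀ {f : ℕ → V} {j : ℕ}, IsLollipop G n f j →
      ((Finset.range n).image (lollipopEdge n f j)).card = n := by
    intro f j hf
    rw [Finset.card_image_of_injOn, Finset.card_range]
    intro a ha b hb hab
    exact hf.lollipopEdge_inj a b (by simpa using ha) (by simpa using hb) hab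
  have hsub : (Finset.range n).image (lollipopEdge n g l) ⊆
      (Finset.range n).image (lollipopEdge n f j) := by
    intro e he
    obtain ⟨i, hi, rfl⟩ := Finset.mem_image.1 he
    obtain ⟨k, hk, hik⟩ := h i (Finset.mem_range.1 hi)
    exact Finset.mem_image.2 ⟨k, Finset.mem_range.2 hk, hik.symm⟩
  have heq := Finset.eq_of_subset_of_card_le hsub (by rw [hcard hf, hcard hg])
  have hedge : ∀ e, e ∈ H.edgeSet ↔ e ∈ K.edgeSet := by
    intro e
    have h1 := Finset.ext_iff.1 heq e
    simp only [Finset.mem_image, Finset.mem_range] at h1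
    rw [hfe, hge, h1]
  refine SimpleGraph.Subgraph.ext ?_ ?_
  · ext v
    constructor
    · intro hv
      obtain ⟨i, hi, rfl⟩ := (hfv v).1 hv
      exact K.mem_verts_of_mem_edge ((hedge _).1 ((hfe _).2 ⟨i, hi, rfl⟩)) (mem_lollipopEdge hi)
    · intro hv
      obtain ⟨i, hi, rfl⟩ := (hgv v).1 hv
      exact H.mem_verts_of_mem_edge ((hedge _).2 ((hge _).2 ⟨i, hi, rfl⟩)) (mem_lollipopEdge hi)
  · ext u v
    exact hedge s(u, v)

end HLine

theorem mainTheorem4 {V : Type*} [Finite V] (G : SimpleGraph V) (n : ℕ) (hn : 4 ≤ n)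
    (G₁ G₂ : G.Subgraph)
    (h₁ : HLine.MemDelta n G₁.coe) (h₂ : HLine.MemDelta n G₂.coe)
    (hcomp : ∃ c : G.ConnectedComponent, G₁.verts ⊆ c.supp ∧ G₂.verts ⊆ c.supp)
    (hne : G₁ ≠ G₂) :
    HLine.DivergesByOrder (SimpleGraph.pathGraph n) G := by
  obtain ⟨f, j, hf, hfv, hfe⟩ := h₁.exists_isLollipop
  obtain ⟨g, l, hg, hgv, hge⟩ := h₂.exists_isLollipop
  obtain ⟨c, hc₁, hc₂⟩ := hcomp
  have hr : G.Reachable (f 0) (g 0) := by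
    have h1 := hc₁ ((hfv _).2 ⟨0, by omega, rfl⟩)
    have h2 := hc₂ ((hgv _).2 ⟨0, by omega, rfl⟩)
    rw [SimpleGraph.ConnectedComponent.mem_supp_iff] at h1 h2
    exact SimpleGraph.ConnectedComponent.exact (h1.trans h2.symm)
  have hex : ∃ i < n, ∀ k < n, HLine.lollipopEdge n g l i ≠ HLine.lollipopEdge n f j k := by
    by_contra! hcon
    exact hne (HLine.subgraph_eq_of_lollipops hf hg hfv hgv hfe hge hcon)
  have h : HLine.HasTwoLollipops G n j := ⟨f, g, l, hf, hg, hr, hex⟩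
  exact (h.exists_hasTouchedCycle (by omega)).divergesByOrder (by omega) le_rfl
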